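/- Let $d\ge 2$ and $m>0$. For $k=(k^0,\mathbf k)\in\mathbb R\times\mathbb R^{d-1}$ put $k^2=(k^0)^2-|\mathbf k|^2$ and $\omega=\sqrt{|\mathbf k|^2+m^2}$, and let $\theta$ be the Heaviside function. The following tempered distributions on $\mathbb R^d$ are well defined: $\delta'^{\pm}_m(k)=\theta(\pm k^0)\,\delta'(k^2-m^2)$, that is, $$\langle\delta'^{\pm}_m,f\rangle=-\frac{d}{dM}\Big|_{M=m^2}\int_{\mathbb R^{d-1}}\frac{f\big(\pm\sqrt{|\mathbf k|^2+M},\mathbf k\big)}{2\sqrt{|\mathbf k|^2+M}}\,d\mathbf k ,$$ and the principal value $\mathrm{PV}\,\frac1{(k^2-m^2)^2}$, that is, $$\Big\langle \mathrm{PV}\tfrac1{(k^2-m^2)^2},f\Big\rangle=\lim_{r\to0^+}\left[\int_{|k^2-m^2|>r}\frac{f(k)}{(k^2-m^2)^2}\,dk-\frac2r\int_{\mathbb R^{d-1}}\frac{f(\omega,\mathbf k)+f(-\omega,\mathbf k)}{2\omega}\,d\mathbf k\right].$$ Let $0<\epsilon<m^2$, let $\varphi\in C_0^\infty(\mathbb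 R,\mathbb R)$ have support in $(-\epsilon,\epsilon)$ with $\varphi(\kappa)=1$ for $\kappa\in(-\epsilon/2,\epsilon/2)$, and put $\chi^\pm(k)=\theta(\pm k^0)\varphi(k^2-m^2)$. For $t\in\mathbb R$ let $$\chi_t(\mathrm{in},k)=\chi^+(k)e^{-i(k^0-\omega)t}+\chi^-(k)e^{-i(k^0+\omega)t},\qquad \chi_t(\mathrm{out},k)=\chi^+(k)e^{i(k^0-\omega)t}+\chi^-(k)e^{i(k^0+\omega)t},$$ $$\chi^d_t(\mathrm{in},k)=\Big[1+\frac{it}{2k^0}(k^2-m^2)\Big]\chi_t(\mathrm{in},k),\qquad \chi^d_t(\mathrm{out},k)=\Big[1-\frac{it}{2k^0}(k^2-m^2)\Big]\chi_t(\mathrm{out},k),\qquad \chi^d_t(\mathrm{loc},k)=1 .$$ These are smooth functions of temperate growth on $\mathbb R^d$. Let $\frac{\chi^d_t(a,k)}{(k^2-m^2)^2}$ denote the product of the function $\chi^d_t(a,\cdot)$ with the tempered distribution $\mathrm{PV}\frac1{(k^2-m^2)^2}$. Then for every $a\in\{\mathrm{in},\mathrm{loc},\mathrm{out}\}$, as $t\to+\infty$,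 $$\frac{\chi^d_t(a,k)}{(k^2-m^2)^2}\longrightarrow\hat\Delta'_m(a,k)=\begin{cases} i\pi\big(\delta'^{+}_m(k)-\delta'^{-}_m(k)\big)& a=\mathrm{in},\\ \mathrm{PV}\,\dfrac1{(k^2-m^2)^2}& a=\mathrm{loc},\\ -i\pi\big(\delta'^{+}_m(k)-\delta'^{-}_m(k)\big)& a=\mathrm{out},\end{cases}$$ in the space of tempered distributions $\mathcal S'(\mathbb R^d)$, i.e. after pairing with any fixed Schwartz function. -/

import Mathlib

open MeasureTheory Filter Topology
open scoped SchwartzMap ContDiff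

namespace DipoleField

/-- Momentum space `ℝ^d` for `d ≥ 1`: the points are `k = (k⁰, 𝐤)` with energy `k⁰ ∈ ℝ` and spatial
momentum `𝐤 ∈ ℝ^(d-1)`. -/
abbrev Momentum (d : ℕ) : Type := ℝ × EuclideanSpace ℝ (Fin (d - 1))

/-- The Minkowski square `k² = (k⁰)² - |𝐤|²`. -/
noncomputable def minkowskiSq {d : ℕ} (k : Momentum d) : ℝ := k.1 ^ 2 - ‖k.2‖ ^ 2

/-- The energy `√(|𝐤|² + M)` of a particle with squared mass `M` and spatial momentum `𝐤`. -/
noncomputable def energy {d : ℕ} (M : ℝ) (p : EuclideanSpace ℝ (Fin (d - 1))) : ℝ :=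
  Real.sqrt (‖p‖ ^ 2 + M)

/-- `∫ θ(k⁰) δ(k² - M) f(k) dk` for `M > 0`. -/
noncomputable def shellPos {d : ℕ} (M : ℝ) (f : Momentum d → ℂ) : ℂ :=
  ∫ p : EuclideanSpace ℝ (Fin (d - 1)), f (energy M p, p) / ((2 * energy M p : ℝ) : ℂ)

/-- `∫ θ(-k⁰) δ(k² - M) f(k) dk` for `M > 0`. -/
noncomputable def shellNeg {d : ℕ} (M : ℝ) (f : Momentum d → ℂ) : ℂ :=
  ∫ p : EuclideanSpace ℝ (Fin (d - 1)), f (-energy M p, p) / ((2 * energy M p : ℝ) : ℂ)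

/-- `D = θ(k⁰) δ'(k² - m²)`: since `δ'(u) = -(d/ds) δ(u - s)` at `s = 0`, the distribution
`θ(k⁰) δ'(k² - m²)` is minus the derivative of `θ(k⁰) δ(k² - M)` in `M` at `M = m²`. -/
def IsDeltaPrimePos {d : ℕ} (m : ℝ) (D : 𝓢'(Momentum d, ℂ)) : Prop :=
  ∀ f : 𝓢(Momentum d, ℂ), HasDerivAt (fun M : ℝ => shellPos M f) (-(D f)) (m ^ 2)

/-- `D = θ(-k⁰) δ'(k² - m²)`, in the same sense. -/
def IsDeltaPrimeNeg {d : ℕ} (m : ℝ) (D : 𝓢'(Momentum d, ℂ)) : Prop :=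
  ∀ f : 𝓢(Momentum d, ℂ), HasDerivAt (fun M : ℝ => shellNeg M f) (-(D f)) (m ^ 2)

/-- `P = PV 1/(k² - m²)²`, the principal value (finite part) at a double pole:
`P f = lim_{r → 0+} [ ∫_{|k² - m²| > r} f(k)/(k² - m²)² dk - (2/r) ∫ δ(k² - m²) f(k) dk ]`,
the pullback under `u = k² - m²` of
`PV 1/u² = -(d/du) PV 1/u`, `g ↦ lim_{r → 0+} [ ∫_{|u| > r} g(u)/u² du - 2 g(0)/r ]`. -/
def IsPVInvSq {d : ℕ} (m : ℝ) (P : 𝓢'(Momentum d, ℂ)) : Prop :=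
  ∀ f : 𝓢(Momentum d, ℂ), Tendsto
    (fun r : ℝ =>
      (∫ k in {k : Momentum d | r < |minkowskiSq k - m ^ 2|},
          f k / (((minkowskiSq k - m ^ 2) ^ 2 : ℝ) : ℂ))
        - ((2 / r : ℝ) : ℂ) * (shellPos (m ^ 2) f + shellNeg (m ^ 2) f))
    (𝓝[>] 0) (𝓝 (P f))

/-- The three labels in / loc / out. -/
inductive Channel
  | incoming
  | loc
  | outgoing

/-- `χ⁺(k) = θ(k⁰) φ(k² - m²)`. -/
noncomputable def chiPos {d : ℕ} (m : ℝ) (φ : ℝ → ℝ) (k : Momentum d) : ℂ :=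
  if 0 < k.1 then ((φ (minkowskiSq k - m ^ 2) : ℝ) : ℂ) else 0

/-- `χ⁻(k) = θ(-k⁰) φ(k² - m²)`. -/
noncomputable def chiNeg {d : ℕ} (m : ℝ) (φ : ℝ → ℝ) (k : Momentum d) : ℂ :=
  if k.1 < 0 then ((φ (minkowskiSq k - m ^ 2) : ℝ) : ℂ) else 0

/-- The Haag-Ruelle multiplier `χ_t(a, k)`, with `ω = √(|𝐤|² + m²)`. -/
noncomputable def chi {d : ℕ} (m : ℝ) (φ : ℝ → ℝ) (t : ℝ) : Channel → Momentum d → ℂ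
  | .incoming, k =>
      chiPos m φ k * Complex.exp (-Complex.I * ((k.1 - energy (m ^ 2) k.2 : ℝ) : ℂ) * (t : ℂ))
        + chiNeg m φ k * Complex.exp (-Complex.I * ((k.1 + energy (m ^ 2) k.2 : ℝ) : ℂ) * (t : ℂ))
  | .loc, _ => 1
  | .outgoing, k =>
      chiPos m φ k * Complex.exp (Complex.I * ((k.1 - energy (m ^ 2) k.2 : ℝ) : ℂ) * (t : ℂ))
        + chiNeg m φ k * Complex.exp (Complex.I * ((k.1 + energy (m ^ 2) k.2 : ℝ) : ℂ) * (t : ℂ))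

/-- The dipole multiplier `χ^d_t(a, k)`. The value of `1/(2k⁰)` at `k⁰ = 0` is irrelevant, because
`χ_t(in/out, k)` vanishes there. -/
noncomputable def chiDipole {d : ℕ} (m : ℝ) (φ : ℝ → ℝ) (t : ℝ) : Channel → Momentum d → ℂ
  | .incoming, k =>
      (1 + Complex.I * (t : ℂ) / ((2 * k.1 : ℝ) : ℂ) * ((minkowskiSq k - m ^ 2 : ℝ) : ℂ))
        * chi m φ t .incoming k
  | .loc, _ => 1
  | .outgoing, k =>
      (1 - Complex.I * (t : ℂ) / ((2 * k.1 : ℝ) : ℂ) * ((minkowskiSq k - m ^ 2 : ℝ) : ℂ))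
        * chi m φ t .outgoing k

/-- The limit distribution `Δ̂'_m(a, ·)`, written in terms of `Dp = δ'^+_m`, `Dn = δ'^-_m` and
`P = PV 1/(k² - m²)²`. -/
noncomputable def dipoleDelta {d : ℕ} (Dp Dn P : 𝓢'(Momentum d, ℂ)) :
    Channel → 𝓢'(Momentum d, ℂ)
  | .incoming => (Complex.I * (Real.pi : ℂ)) • (Dp - Dn)
  | .loc => P
  | .outgoing => (-(Complex.I * (Real.pi : ℂ))) • (Dp - Dn)

end DipoleField

/-! On the line of fixed spatial momentum `p`, put `s = k⁰ - ω`, so that `k² - m² = s (s + 2ω)`. For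
`|s| ≤ m` the only pole of `1/(k² - m²)²` on the half-space `k⁰ > 0` is the double pole at `s = 0`.
Hence the positive-energy half of the principal value is an absolutely convergent integral away from
the shell, plus the integral over `p` of the one-variable finite part of `F(s)/s²` with `F = f/(s +
2ω)²` (`tendsto_posEnergy_cutoff`). The negative-energy half follows by reflecting `k⁰`.

Write `u = k² - m²`, and let `g` be `f/k⁰` times the cutoff `φ(u)`. On `k⁰ > 0` the multiplied test
function is `(k⁰ + (it/2) u) e^{-ist} g`. With `B = e^{-ist} g / (2(s + 2ω))` and `J = e^{-ist} ∂₀g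
/ (2(s + 2ω))`, its fibre is exactly `F = B - s B' + s J`. This is the purpose of the dipole factor:
`(B - s B')/s²` is the total derivative `-(B/s)'`. Since `B` vanishes at `s = ±m`, it contributes
nothing to the finite part, and all terms growing in `t` disappear. What remains is `∫ (J(s) -
J(0))/s ds`, a principal value against `1/s` (`finitePart_by_parts`, `fiberPart_eq`).

Splitting off the value of `∂₀g/(s + 2ω)` at `s = 0` leaves an integral that vanishes by
Riemann-Lebesgue and a multiple of `∫ (e^{-ist} - 1)/s ds` over `[-m, m]`, which tends to `∓iπ` as
`t → ±∞` (`tendsto_boxOsc_atTop`). The coefficient is `∂₀(f/k⁰)/(4ω)` on the shell. It equals the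
`M`-derivative of `f(√(|p|² + M), p)/(2√(|p|² + M))` at `M = m²`, whose integral over `p` is
`-δ'⁺(f)` (`half_fiber_timeDeriv_eq`, `hasDerivAt_shellPos`). Every bound on a fibre is a Schwartz
seminorm times an integrable weight in `p`, so limits pass through the `p`-integral.

Reflection turns the negative shell into the positive one with `t` replaced by `-t`, whence the
relative sign of `δ'⁺` and `δ'⁻`. The outgoing multiplier is the incoming one at `-t`. -/

namespace DipoleField

/-! ### Finite parts at a double pole in one variable -/

/-- The finite part of `∫ F(s)/s² ds` over `[-m, m]`, where `c = F'(0)`. -/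
noncomputable def finitePart (m : ℝ) (F : ℝ → ℂ) (c : ℂ) : ℂ :=
  (∫ s in -m..m, (F s - F 0 - s * c) / (s : ℂ) ^ 2) - 2 * F 0 / m

theorem norm_sub_le_of_hasDerivAt {m C : ℝ} {F F1 : ℝ → ℂ}
    (h0 : ∀ s ∈ Set.Icc (-m) m, HasDerivAt F (F1 s) s)
    (h1 : ∀ s ∈ Set.Icc (-m) m, ‖F1 s‖ ≤ C) {s : ℝ} (hs : s ∈ Set.Icc (-m) m) :
    ‖F s - F 0‖ ≤ C * |s| := by
  have hm : (0 : ℝ) ∈ Set.Icc (-m) m := by constructor <;> linarith [hs.1, hs.2]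
  have := (convex_Icc (-m) m).norm_image_sub_le_of_norm_hasDerivWithin_le (f := F) (f' := F1)
    (fun x hx => (h0 x hx).hasDerivWithinAt) h1 hm hs
  simpa using this

/-- The mean value inequality is applied to `F x - x F'(0)` on `[-|s|, |s|]`, where the derivative
is already at most `C |s|`. The factor `1/2` of Taylor's formula is not needed. -/
theorem norm_taylor_le {m C : ℝ} {F F1 F2 : ℝ → ℂ}
    (h0 : ∀ s ∈ Set.Icc (-m) m, HasDerivAt F (F1 s) s)
    (h1 : ∀ s ∈ Set.Icc (-m) m, HasDerivAt F1 (F2 s) s)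
    (h2 : ∀ s ∈ Set.Icc (-m) m, ‖F2 s‖ ≤ C) {s : ℝ} (hs : s ∈ Set.Icc (-m) m) :
    ‖F s - F 0 - s * F1 0‖ ≤ C * s ^ 2 := by
  have hsub : Set.Icc (-|s|) |s| ⊆ Set.Icc (-m) m := by
    have := abs_le.2 hs
    exact Set.Icc_subset_Icc (by linarith) this
  have hm : (0 : ℝ) ∈ Set.Icc (-m) m := by constructor <;> linarith [hs.1, hs.2]
  have hC : 0 ≤ C := (norm_nonneg _).trans (h2 0 hm)
  have key := norm_sub_le_of_hasDerivAt (m := |s|) (C := C * |s|)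
    (F := fun x => F x - x * F1 0) (F1 := fun x => F1 x - F1 0)
    (fun x hx => by
      have h := ((hasDerivAt_id x).ofReal_comp).mul_const (F1 0)
      simpa using (h0 x (hsub hx)).fun_sub h)
    (fun x hx => by
      refine (norm_sub_le_of_hasDerivAt h1 h2 (hsub hx)).trans ?_
      exact mul_le_mul_of_nonneg_left (abs_le.2 hx) hC)
    (s := s) ⟨neg_abs_le s, le_abs_self s⟩
  have e : F s - F 0 - s * F1 0 = (F s - s * F1 0) - (F 0 - (0 : ℝ) * F1 0) := by
    push_cast; ring
  rw [e]
  refine key.trans (le_of_eq ?_)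
  rw [mul_assoc, abs_mul_abs_self, sq]

theorem intervalIntegrable_of_norm_le {m C : ℝ} {F : ℝ → ℂ}
    (hF : AEStronglyMeasurable F (volume.restrict (Set.uIoc (-m) m)))
    (h : ∀ s ∈ Set.uIoc (-m) m, ‖F s‖ ≤ C) : IntervalIntegrable F volume (-m) m := by
  rw [intervalIntegrable_iff]
  refine Integrable.mono' (g := fun _ => C) (by simp [Set.uIoc]) hF ?_
  · exact (ae_restrict_iff' measurableSet_uIoc).2 (Eventually.of_forall h)

/-- At `s = 0` the quotient is `0` by convention, so the pole need not be excluded. -/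
theorem norm_div_sq_le {C s : ℝ} {z : ℂ} (hC : 0 ≤ C) (h : ‖z‖ ≤ C * s ^ 2) :
    ‖z / (s : ℂ) ^ 2‖ ≤ C := by
  rw [norm_div, norm_pow, Complex.norm_real, Real.norm_eq_abs, sq_abs]
  exact div_le_of_le_mul₀ (sq_nonneg s) hC h

theorem norm_div_le {C s : ℝ} {z : ℂ} (hC : 0 ≤ C) (h : ‖z‖ ≤ C * |s|) :
    ‖z / (s : ℂ)‖ ≤ C := by
  rw [norm_div, Complex.norm_real, Real.norm_eq_abs]
  exact div_le_of_le_mul₀ (abs_nonneg s) hC h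

theorem norm_finitePart_le {m C : ℝ} (hm : 0 < m) {F : ℝ → ℂ} {c : ℂ}
    (hC : ∀ s ∈ Set.Icc (-m) m, ‖F s - F 0 - s * c‖ ≤ C * s ^ 2) :
    ‖finitePart m F c‖ ≤ 2 * m * C + 2 / m * ‖F 0‖ := by
  have hC0 : 0 ≤ C := by
    have := (norm_nonneg _).trans (hC m ⟨by linarith, le_rfl⟩)
    exact nonneg_of_mul_nonneg_left this (by positivity)
  refine (norm_sub_le _ _).trans (add_le_add ?_ ?_)
  · have := intervalIntegral.norm_integral_le_of_norm_le_const (a := -m) (b := m) (C := C)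
      (f := fun s : ℝ => (F s - F 0 - s * c) / (s : ℂ) ^ 2) (fun s hs => by
        rw [Set.uIoc_of_le (by linarith)] at hs
        exact norm_div_sq_le hC0 (hC s ⟨hs.1.le, hs.2⟩))
    refine this.trans (le_of_eq ?_)
    rw [abs_of_pos (by linarith)]; ring
  · rw [norm_div, norm_mul, Complex.norm_real, Real.norm_eq_abs, abs_of_pos hm]
    simp only [Complex.norm_ofNat]
    exact le_of_eq (by ring)

theorem aestronglyMeasurable_remainder {m : ℝ} {F : ℝ → ℂ} (c : ℂ)
    (hF : ContinuousOn F (Set.Icc (-m) m)) :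
    AEStronglyMeasurable (fun s : ℝ => (F s - F 0 - s * c) / (s : ℂ) ^ 2)
      (volume.restrict (Set.Ioc (-m) m)) := by
  have h : AEMeasurable F (volume.restrict (Set.Ioc (-m) m)) :=
    ((hF.mono Set.Ioc_subset_Icc_self).aestronglyMeasurable measurableSet_Ioc).aemeasurable
  refine AEMeasurable.aestronglyMeasurable ?_
  exact ((h.sub aemeasurable_const).sub
    (by fun_prop)).div (by fun_prop)

theorem intervalIntegrable_remainder {m C : ℝ} (hm : 0 < m) {F : ℝ → ℂ} {c : ℂ}
    (hF : ContinuousOn F (Set.Icc (-m) m))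
    (hC : ∀ s ∈ Set.Icc (-m) m, ‖F s - F 0 - s * c‖ ≤ C * s ^ 2) :
    IntervalIntegrable (fun s : ℝ => (F s - F 0 - s * c) / (s : ℂ) ^ 2) volume (-m) m := by
  have hC0 : 0 ≤ C := by
    have := (norm_nonneg _).trans (hC m ⟨by linarith, le_rfl⟩)
    exact nonneg_of_mul_nonneg_left this (by positivity)
  have e : Set.uIoc (-m) m = Set.Ioc (-m) m := Set.uIoc_of_le (by linarith)
  refine intervalIntegrable_of_norm_le (C := C) ?_ ?_
  · rw [e]; exact aestronglyMeasurable_remainder c hF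
  · rw [e]; exact fun s hs => norm_div_sq_le hC0 (hC s ⟨hs.1.le, hs.2⟩)

theorem integral_polar_part {x y : ℝ} (h : x ≤ y) (h0 : 0 < x ∨ y < 0) (A c : ℂ) :
    IntervalIntegrable (fun s : ℝ => A / (s : ℂ) ^ 2 + c / (s : ℂ)) volume x y ∧
    ∫ s in x..y, (A / (s : ℂ) ^ 2 + c / (s : ℂ)) =
      A * (1 / x - 1 / y) + c * ((Real.log y - Real.log x : ℝ) : ℂ) := by
  have hne : ∀ s ∈ Set.uIcc x y, s ≠ 0 := by
    intro s hs
    rw [Set.uIcc_of_le h] at hs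
    rcases h0 with h0 | h0
    · exact (h0.trans_le hs.1).ne'
    · exact (hs.2.trans_lt h0).ne
  have hi : IntervalIntegrable (fun s : ℝ => A / (s : ℂ) ^ 2 + c / (s : ℂ)) volume x y := by
    apply ContinuousOn.intervalIntegrable
    refine ContinuousOn.add (ContinuousOn.div (by fun_prop) (by fun_prop) ?_)
      (ContinuousOn.div (by fun_prop) (by fun_prop) ?_)
    · intro s hs; exact pow_ne_zero _ (Complex.ofReal_ne_zero.2 (hne s hs))
    · intro s hs; exact Complex.ofReal_ne_zero.2 (hne s hs)
  refine ⟨hi, ?_⟩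
  rw [intervalIntegral.integral_eq_sub_of_hasDerivAt
    (f := fun s : ℝ => -A * ((s⁻¹ : ℝ) : ℂ) + c * ((Real.log s : ℝ) : ℂ)) ?_ hi]
  · push_cast; ring
  · intro s hs
    have h1 := ((hasDerivAt_inv (hne s hs)).ofReal_comp).const_mul (-A)
    have h2 := ((Real.hasDerivAt_log (hne s hs)).ofReal_comp).const_mul c
    convert h1.fun_add h2 using 1
    push_cast; ring

/-- The cutoff `|s (s + 2w)| > r` removes the asymmetric interval `[-a, b]` with `a (2w - a) = r = b
(b + 2w)`. The asymmetry is harmless: `1/a + 1/b` differs from `4w/r` by `O(r)`, `log a - log b` is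
`O(r)`, and the bounded remainder loses an interval of length `O(r)`. The constant does not depend
on `w ≥ m`, which allows integration over the spatial momentum. -/
theorem norm_cutoff_sub_finitePart_le {m w r C : ℝ} (hm : 0 < m) (hw : m ≤ w) (hr : 0 < r)
    (hrm : r < m ^ 2) {F : ℝ → ℂ} {c : ℂ} (hF : ContinuousOn F (Set.Icc (-m) m))
    (hC : ∀ s ∈ Set.Icc (-m) m, ‖F s - F 0 - s * c‖ ≤ C * s ^ 2) :
    ‖(∫ s in {s : ℝ | s ∈ Set.Ioc (-m) m ∧ r < |s * (s + 2 * w)|}, F s / (s : ℂ) ^ 2)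
      - 4 * w * F 0 / r - finitePart m F c‖
      ≤ (‖F 0‖ / m ^ 3 + 2 * ‖c‖ / m ^ 2 + 2 * C / m) * r := by
  have hC0 : 0 ≤ C := by
    have := (norm_nonneg _).trans (hC m ⟨by linarith, le_rfl⟩)
    exact nonneg_of_mul_nonneg_left this (by positivity)
  have hw0 : 0 < w := hm.trans_le hw
  obtain ⟨b, hb0, hb⟩ : ∃ b : ℝ, 0 < b ∧ b * (b + 2 * w) = r := by
    refine ⟨√(w ^ 2 + r) - w, ?_, ?_⟩
    · have : w < √(w ^ 2 + r) := Real.lt_sqrt_of_sq_lt (by linarith)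
      linarith
    · have := Real.sq_sqrt (show 0 ≤ w ^ 2 + r by positivity)
      nlinarith
  obtain ⟨a, ha0, haw, ha⟩ : ∃ a : ℝ, 0 < a ∧ a ≤ w ∧ a * (2 * w - a) = r := by
    have hpos : 0 ≤ w ^ 2 - r := by nlinarith
    refine ⟨w - √(w ^ 2 - r), ?_, ?_, ?_⟩
    · have : √(w ^ 2 - r) < w := by
        rw [Real.sqrt_lt' hw0]; linarith
      linarith
    · linarith [Real.sqrt_nonneg (w ^ 2 - r)]
    · have := Real.sq_sqrt hpos
      nlinarith
  -- If `a ≥ m`, then `r = a (2w - a) ≥ a w ≥ m²`; similarly for `b`.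
  have ham : a < m := by nlinarith
  have hbm : b < m := by nlinarith
  have har : a * w ≤ r := by nlinarith
  have hbr : b * (2 * w) ≤ r := by nlinarith
  have ham' : a ≤ r / m := by rw [le_div_iff₀ hm]; nlinarith
  have hbm' : b ≤ r / m := by rw [le_div_iff₀ hm]; nlinarith
  have hset : {s : ℝ | s ∈ Set.Ioc (-m) m ∧ r < |s * (s + 2 * w)|}
      = Set.Ioo (-m) (-a) ∪ Set.Ioc b m := by
    ext s
    simp only [Set.mem_ofPred_eq, Set.mem_Ioc, Set.mem_union, Set.mem_Ioo]
    constructor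
    · rintro ⟨⟨h1, h2⟩, h3⟩
      have hs : 0 < s + 2 * w := by linarith
      rw [abs_mul, abs_of_pos hs] at h3
      rcases le_total 0 s with h | h
      · right
        rw [abs_of_nonneg h] at h3
        refine ⟨?_, h2⟩
        by_contra! hle
        nlinarith
      · left
        rw [abs_of_nonpos h] at h3
        refine ⟨h1, ?_⟩
        by_contra! hle
        nlinarith
    · rintro (⟨h1, h2⟩ | ⟨h1, h2⟩)
      · have hs : 0 < s + 2 * w := by linarith
        refine ⟨⟨h1, by linarith⟩, ?_⟩
        rw [abs_mul, abs_of_pos hs, abs_of_neg (by linarith)]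
        nlinarith
      · refine ⟨⟨by linarith, h2⟩, ?_⟩
        rw [abs_of_pos (by nlinarith)]
        nlinarith
  set Q : ℝ → ℂ := fun s => (F s - F 0 - s * c) / (s : ℂ) ^ 2 with hQ
  have hQi : IntervalIntegrable Q volume (-m) m := intervalIntegrable_remainder hm hF hC
  have hsub : ∀ x y : ℝ, -m ≤ x → x ≤ y → y ≤ m → IntervalIntegrable Q volume x y := by
    intro x y h1 h2 h3
    refine hQi.mono_set ?_
    rw [Set.uIcc_of_le h2, Set.uIcc_of_le (by linarith)]
    exact Set.Icc_subset_Icc h1 h3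
  have hsplit : ∀ s : ℝ, s ≠ 0 → F s / (s : ℂ) ^ 2 = Q s + (F 0 / (s : ℂ) ^ 2 + c / (s : ℂ)) := by
    intro s hs
    have : (s : ℂ) ≠ 0 := Complex.ofReal_ne_zero.2 hs
    simp only [hQ]
    field_simp
    ring
  have hpiece : ∀ x y : ℝ, -m ≤ x → x ≤ y → y ≤ m → (0 < x ∨ y < 0) →
      IntervalIntegrable (fun s : ℝ => F s / (s : ℂ) ^ 2) volume x y ∧
      ∫ s in x..y, F s / (s : ℂ) ^ 2 = (∫ s in x..y, Q s) +
        (F 0 * (1 / x - 1 / y) + c * ((Real.log y - Real.log x : ℝ) : ℂ)) := by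
    intro x y h1 h2 h3 h4
    obtain ⟨hi, he⟩ := integral_polar_part h2 h4 (F 0) c
    have hcongr : Set.EqOn (fun s : ℝ => Q s + (F 0 / (s : ℂ) ^ 2 + c / (s : ℂ)))
        (fun s : ℝ => F s / (s : ℂ) ^ 2) (Set.uIcc x y) := by
      intro s hs
      rw [Set.uIcc_of_le h2] at hs
      refine (hsplit s ?_).symm
      rcases h4 with h4 | h4
      · exact (h4.trans_le hs.1).ne'
      · exact (hs.2.trans_lt h4).ne
    refine ⟨((hsub x y h1 h2 h3).add hi).congr (fun s hs => hcongr (Set.uIoc_subset_uIcc hs)), ?_⟩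
    rw [← intervalIntegral.integral_congr hcongr,
      intervalIntegral.integral_add (hsub x y h1 h2 h3) hi, he]
  obtain ⟨hi1, he1⟩ := hpiece (-m) (-a) le_rfl (by linarith) (by linarith) (Or.inr (by linarith))
  obtain ⟨hi2, he2⟩ := hpiece b m (by linarith) (by linarith) le_rfl (Or.inl hb0)
  have hI : (∫ s in {s : ℝ | s ∈ Set.Ioc (-m) m ∧ r < |s * (s + 2 * w)|}, F s / (s : ℂ) ^ 2)
      = (∫ s in -m..-a, F s / (s : ℂ) ^ 2) + ∫ s in b..m, F s / (s : ℂ) ^ 2 := by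
    rw [hset, setIntegral_union ?_ measurableSet_Ioc, ← integral_Ioc_eq_integral_Ioo,
      ← intervalIntegral.integral_of_le (by linarith), ← intervalIntegral.integral_of_le hbm.le]
    · rw [intervalIntegrable_iff_integrableOn_Ioo_of_le (by linarith)] at hi1
      exact hi1
    · rw [intervalIntegrable_iff_integrableOn_Ioc_of_le hbm.le] at hi2
      exact hi2
    · rw [Set.disjoint_left]
      rintro s ⟨_, h1⟩ ⟨h2, _⟩
      linarith
  have hmid : (∫ s in -m..m, Q s) = (∫ s in -m..-a, Q s) + (∫ s in -a..b, Q s)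
      + ∫ s in b..m, Q s := by
    rw [intervalIntegral.integral_add_adjacent_intervals (hsub _ _ le_rfl (by linarith)
      (by linarith)) (hsub _ _ (by linarith) (by linarith) (by linarith)),
      intervalIntegral.integral_add_adjacent_intervals (hsub _ _ le_rfl (by linarith)
      (by linarith)) (hsub _ _ (by linarith) (by linarith) (by linarith))]
  have hmidle : ‖∫ s in -a..b, Q s‖ ≤ 2 * C / m * r := by
    have := intervalIntegral.norm_integral_le_of_norm_le_const (a := -a) (b := b) (C := C)
      (f := Q) (fun s hs => by
        rw [Set.uIoc_of_le (by linarith)] at hs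
        exact norm_div_sq_le hC0 (hC s ⟨by linarith [hs.1], by linarith [hs.2]⟩))
    refine this.trans ?_
    rw [abs_of_pos (by linarith)]
    have : C * (b - -a) ≤ C * (r / m + r / m) := by gcongr; linarith
    refine this.trans (le_of_eq (by ring))
  -- The two equations for `r` give `a/b = (b + 2w)/(2w - a) ≥ 1`, and `log x ≤ x - 1` leaves `(a +
  -- b)/(2w - a)`.
  have hlog : |Real.log a - Real.log b| ≤ 2 / m ^ 2 * r := by
    have hq : a / b = (b + 2 * w) / (2 * w - a) := by
      rw [div_eq_div_iff hb0.ne' (by linarith)]; linarith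
    have hden : 0 < 2 * w - a := by linarith
    rw [← Real.log_div ha0.ne' hb0.ne', hq]
    have h1 : 1 ≤ (b + 2 * w) / (2 * w - a) := by rw [le_div_iff₀ hden]; linarith
    rw [abs_of_nonneg (Real.log_nonneg h1)]
    refine (Real.log_le_sub_one_of_pos (by linarith)).trans ?_
    have : (b + 2 * w) / (2 * w - a) - 1 = (a + b) / (2 * w - a) := by
      field_simp; ring
    rw [this, div_le_iff₀ hden]
    have h2 : a + b ≤ 2 * r / m := by
      have : 2 * r / m = r / m + r / m := by ring
      linarith
    have h3 : 2 / m ^ 2 * r * (2 * w - a) = 2 * r / m * ((2 * w - a) / m) := by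
      field_simp
    rw [h3]
    have h4 : 1 ≤ (2 * w - a) / m := by rw [le_div_iff₀ hm]; linarith
    have h5 : 0 ≤ 2 * r / m := by positivity
    nlinarith
  -- Here `1/a + 1/b = (4w + b - a)/r`, and equating the two expressions for `r` gives `b - a = -(a²
  -- + b²)/(2w)`, which is of second order in `r`.
  have hpole : |1 / a + 1 / b - 4 * w / r| ≤ 1 / m ^ 3 * r := by
    have h1 : 1 / a = (2 * w - a) / r := by
      rw [div_eq_div_iff ha0.ne' hr.ne']; linarith
    have h2 : 1 / b = (b + 2 * w) / r := by
      rw [div_eq_div_iff hb0.ne' hr.ne']; linarith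
    have h3 : 1 / a + 1 / b - 4 * w / r = -((a ^ 2 + b ^ 2) / (2 * w * r)) := by
      rw [h1, h2]
      field_simp
      nlinarith
    rw [h3, abs_neg, abs_of_pos (by positivity), div_le_iff₀ (by positivity)]
    have h6 : a ^ 2 + b ^ 2 ≤ (r / m) ^ 2 + (r / m) ^ 2 := by gcongr
    refine h6.trans ?_
    have h7 : 1 / m ^ 3 * r * (2 * w * r) = (r / m) ^ 2 * (2 * (w / m)) := by
      field_simp
    rw [h7]
    have h8 : 1 ≤ w / m := by rw [le_div_iff₀ hm]; linarith
    nlinarith [sq_nonneg (r / m)]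
  have hfin : (∫ s in {s : ℝ | s ∈ Set.Ioc (-m) m ∧ r < |s * (s + 2 * w)|}, F s / (s : ℂ) ^ 2)
      - 4 * w * F 0 / r - finitePart m F c
      = F 0 * ((1 / a + 1 / b - 4 * w / r : ℝ) : ℂ) + c * ((Real.log a - Real.log b : ℝ) : ℂ)
        - ∫ s in -a..b, Q s := by
    rw [hI, he1, he2, finitePart]
    change _ - ((∫ s in -m..m, Q s) - _) = _
    rw [hmid]
    simp only [Real.log_neg_eq_log]
    have : (r : ℂ) ≠ 0 := Complex.ofReal_ne_zero.2 hr.ne'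
    have : (a : ℂ) ≠ 0 := Complex.ofReal_ne_zero.2 ha0.ne'
    have : (b : ℂ) ≠ 0 := Complex.ofReal_ne_zero.2 hb0.ne'
    have : (m : ℂ) ≠ 0 := Complex.ofReal_ne_zero.2 hm.ne'
    push_cast
    field_simp
    ring
  rw [hfin]
  refine (norm_sub_le _ _).trans ?_
  refine (add_le_add (norm_add_le _ _) hmidle).trans ?_
  rw [norm_mul, norm_mul, Complex.norm_real, Complex.norm_real, Real.norm_eq_abs,
    Real.norm_eq_abs]
  have h1 := mul_le_mul_of_nonneg_left hpole (norm_nonneg (F 0))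
  have h2 := mul_le_mul_of_nonneg_left hlog (norm_nonneg c)
  refine (add_le_add_left (add_le_add h1 h2) _).trans (le_of_eq ?_)
  ring

/-! ### Integration by parts in the finite part -/

theorem aestronglyMeasurable_diffQuot {m : ℝ} (hm : 0 < m) {J : ℝ → ℂ} (c : ℂ)
    (hJ : ContinuousOn J (Set.Icc (-m) m)) :
    AEStronglyMeasurable (fun s : ℝ => (J s - c) / (s : ℂ))
      (volume.restrict (Set.uIoc (-m) m)) := by
  rw [Set.uIoc_of_le (by linarith)]
  have h : AEMeasurable J (volume.restrict (Set.Ioc (-m) m)) :=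
    ((hJ.mono Set.Ioc_subset_Icc_self).aestronglyMeasurable measurableSet_Ioc).aemeasurable
  exact ((h.sub aemeasurable_const).div (by fun_prop)).aestronglyMeasurable

theorem intervalIntegrable_diffQuot {m D : ℝ} (hm : 0 < m) {J : ℝ → ℂ}
    (hJ : ContinuousOn J (Set.Icc (-m) m))
    (hD : ∀ s ∈ Set.Icc (-m) m, ‖J s - J 0‖ ≤ D * |s|) :
    IntervalIntegrable (fun s : ℝ => (J s - J 0) / (s : ℂ)) volume (-m) m := by
  have hD0 : 0 ≤ D := by
    have := (norm_nonneg _).trans (hD m ⟨by linarith, le_rfl⟩)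
    exact nonneg_of_mul_nonneg_left this (by positivity)
  refine intervalIntegrable_of_norm_le (C := D) (aestronglyMeasurable_diffQuot hm _ hJ) ?_
  rw [Set.uIoc_of_le (by linarith)]
  exact fun s hs => norm_div_le hD0 (hD s ⟨hs.1.le, hs.2⟩)

/-- `(B - B(0) - s B')/s²` is the derivative of `-(B - B(0))/s`. As `B(±m) = 0`, the boundary terms
add up to `2 B(0)/m`, which is precisely what the finite part subtracts. -/
theorem finitePart_by_parts {m C D : ℝ} (hm : 0 < m) {B B1 B2 J : ℝ → ℂ}
    (h0 : ∀ s ∈ Set.Icc (-m) m, HasDerivAt B (B1 s) s)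
    (h1 : ∀ s ∈ Set.Icc (-m) m, HasDerivAt B1 (B2 s) s)
    (h2 : ∀ s ∈ Set.Icc (-m) m, ‖B2 s‖ ≤ C)
    (hBm : B m = 0) (hBm' : B (-m) = 0)
    (hJ : ContinuousOn J (Set.Icc (-m) m))
    (hD : ∀ s ∈ Set.Icc (-m) m, ‖J s - J 0‖ ≤ D * |s|) :
    finitePart m (fun s => B s - s * B1 s + s * J s) (J 0)
      = ∫ s in -m..m, (J s - J 0) / (s : ℂ) := by
  have hmem : (0 : ℝ) ∈ Set.Icc (-m) m := ⟨by linarith, hm.le⟩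
  have hC0 : 0 ≤ C := (norm_nonneg _).trans (h2 0 hmem)
  have hBc : ContinuousOn B (Set.Icc (-m) m) := fun s hs => (h0 s hs).continuousAt.continuousWithinAt
  have hB1c : ContinuousOn B1 (Set.Icc (-m) m) :=
    fun s hs => (h1 s hs).continuousAt.continuousWithinAt
  have e : Set.uIoc (-m) m = Set.Ioc (-m) m := Set.uIoc_of_le (by linarith)
  have hbound : ∀ s ∈ Set.Icc (-m) m, ‖B s - B 0 - s * B1 s‖ ≤ (2 * C) * s ^ 2 := by
    intro s hs
    have t1 := norm_taylor_le h0 h1 h2 hs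
    have t2 := norm_sub_le_of_hasDerivAt h1 h2 hs
    have : B s - B 0 - s * B1 s = (B s - B 0 - s * B1 0) - s * (B1 s - B1 0) := by ring
    rw [this]
    refine (norm_sub_le _ _).trans ?_
    rw [norm_mul, Complex.norm_real, Real.norm_eq_abs]
    have t3 := mul_le_mul_of_nonneg_left t2 (abs_nonneg s)
    have : |s| * (C * |s|) = C * s ^ 2 := by rw [← sq_abs]; ring
    linarith
  have hint : IntervalIntegrable (fun s : ℝ => (B s - B 0 - s * B1 s) / (s : ℂ) ^ 2)
      volume (-m) m := by
    refine intervalIntegrable_of_norm_le (C := 2 * C) ?_ ?_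
    · rw [e]
      have a0 := ((hBc.mono Set.Ioc_subset_Icc_self).aestronglyMeasurable
        (μ := volume) measurableSet_Ioc).aemeasurable
      have a1 := ((hB1c.mono Set.Ioc_subset_Icc_self).aestronglyMeasurable
        (μ := volume) measurableSet_Ioc).aemeasurable
      refine AEMeasurable.aestronglyMeasurable ?_
      exact ((a0.sub aemeasurable_const).sub
        (AEMeasurable.mul (by fun_prop) a1)).div (by fun_prop)
    · rw [e]
      exact fun s hs => norm_div_sq_le (by positivity) (hbound s ⟨hs.1.le, hs.2⟩)
  have hftc : ∫ s in -m..m, (B s - B 0 - s * B1 s) / (s : ℂ) ^ 2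
      = -dslope B 0 m - -dslope B 0 (-m) := by
    -- `dslope` extends the difference quotient continuously to `s = 0`, so the fundamental theorem
    -- applies with the single exceptional point `0`.
    refine integral_eq_of_hasDerivAt_off_countable_of_le (fun s => -dslope B 0 s) _ (by linarith)
      (Set.countable_singleton (0 : ℝ)) ?_ ?_ hint
    · refine ContinuousOn.neg ((continuousOn_dslope (Icc_mem_nhds (by linarith) hm)).2
        ⟨hBc, (h0 0 hmem).differentiableAt⟩)
    · intro s hs
      have hs0 : s ≠ 0 := hs.2
      have hs0' : (s : ℂ) ≠ 0 := Complex.ofReal_ne_zero.2 hs0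
      have d1 := ((h0 s ⟨hs.1.1.le, hs.1.2.le⟩).sub_const (B 0)).fun_div
        ((hasDerivAt_id s).ofReal_comp) hs0'
      have d2 : HasDerivAt (slope B 0) ((B1 s * s - (B s - B 0) * 1) / (s : ℂ) ^ 2) s := by
        refine d1.congr_of_eventuallyEq (Eventually.of_forall fun y => ?_)
        simp only [slope_def_module, sub_zero, Complex.real_smul, id]
        push_cast
        ring
      have d3 := (d2.congr_of_eventuallyEq (dslope_eventuallyEq_slope_of_ne B hs0)).fun_neg
      convert d3 using 1
      ring
  have hsl : ∀ s : ℝ, s ≠ 0 → dslope B 0 s = (B s - B 0) / s := by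
    intro s hs
    rw [dslope_of_ne _ hs, slope_def_module, sub_zero, Complex.real_smul]
    push_cast
    ring
  have hsum : ∀ s : ℝ, ((B s - s * B1 s + s * J s) - (B 0 - (0 : ℝ) * B1 0 + (0 : ℝ) * J 0)
      - s * J 0) / (s : ℂ) ^ 2 = (B s - B 0 - s * B1 s) / (s : ℂ) ^ 2 + (J s - J 0) / (s : ℂ) := by
    intro s
    rcases eq_or_ne s 0 with rfl | hs
    · simp
    · have hs0' : (s : ℂ) ≠ 0 := Complex.ofReal_ne_zero.2 hs
      field_simp
      push_cast
      ring
  have hm' : (m : ℂ) ≠ 0 := Complex.ofReal_ne_zero.2 hm.ne'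
  unfold finitePart
  simp only [hsum]
  rw [intervalIntegral.integral_add hint (intervalIntegrable_diffQuot hm hJ hD), hftc,
    hsl m hm.ne', hsl (-m) (by linarith), hBm, hBm']
  push_cast
  field_simp
  ring

/-! ### The oscillatory integral of `1/s` -/

/-- Riemann-Lebesgue, with `t` rescaled by `2π` to match the normalisation of the Fourier character.
Integrability is not assumed: the phase has modulus one, so for a non-integrable `Q` every integral
is `0` by convention. -/
theorem tendsto_integral_exp_mul_cocompact (Q : ℝ → ℂ) :
    Tendsto (fun t : ℝ => ∫ s : ℝ, Complex.exp (-Complex.I * (s : ℂ) * (t : ℂ)) * Q s)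
      (cocompact ℝ) (𝓝 0) := by
  have h2 : (2 * Real.pi)⁻¹ ≠ 0 := by positivity
  have hc : Tendsto (fun t : ℝ => t * (2 * Real.pi)⁻¹) (cocompact ℝ) (cocompact ℝ) :=
    (Homeomorph.map_cocompact (Homeomorph.mulRight₀ _ h2)).le
  refine ((Real.tendsto_integral_exp_smul_cocompact Q).comp hc).congr fun t => ?_
  refine integral_congr_ae (Eventually.of_forall fun s => ?_)
  simp only [Circle.smul_def, Real.fourierChar_apply, smul_eq_mul]
  congr 2
  have : (Real.pi : ℂ) ≠ 0 := by exact_mod_cast Real.pi_ne_zero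
  push_cast
  field_simp

theorem tendsto_intervalIntegral_exp_mul_cocompact {m : ℝ} (hm : 0 < m) (Q : ℝ → ℂ) :
    Tendsto (fun t : ℝ => ∫ s in -m..m, Complex.exp (-Complex.I * (s : ℂ) * (t : ℂ)) * Q s)
      (cocompact ℝ) (𝓝 0) := by
  refine (tendsto_integral_exp_mul_cocompact ((Set.Ioc (-m) m).indicator Q)).congr fun t => ?_
  rw [intervalIntegral.integral_of_le (by linarith), ← integral_indicator measurableSet_Ioc]
  refine integral_congr_ae (Eventually.of_forall fun s => ?_)
  by_cases hs : s ∈ Set.Ioc (-m) m <;> simp [hs]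

theorem norm_exp_phase (s t : ℝ) : ‖Complex.exp (-Complex.I * (s : ℂ) * (t : ℂ))‖ = 1 := by
  have : -Complex.I * (s : ℂ) * (t : ℂ) = ((-(s * t) : ℝ) : ℂ) * Complex.I := by
    push_cast; ring
  rw [this, Complex.norm_exp_ofReal_mul_I]

theorem norm_exp_phase_sub_one_le (s t : ℝ) :
    ‖Complex.exp (-Complex.I * (s : ℂ) * (t : ℂ)) - 1‖ ≤ |t| * |s| := by
  have : -Complex.I * (s : ℂ) * (t : ℂ) = Complex.I * ((-(s * t) : ℝ) : ℂ) := by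
    push_cast; ring
  rw [this]
  refine Real.norm_exp_I_mul_ofReal_sub_one_le.trans (le_of_eq ?_)
  rw [Real.norm_eq_abs, abs_neg, abs_mul, mul_comm]

/-- `∫ e^{-s²} (e^{-ist} - 1)/s ds`. -/
noncomputable def gaussOsc (t : ℝ) : ℂ :=
  ∫ s : ℝ, (Real.exp (-1 * s ^ 2) : ℂ) *
    ((Complex.exp (-Complex.I * (s : ℂ) * (t : ℂ)) - 1) / (s : ℂ))

theorem integrable_gaussOsc (t : ℝ) :
    Integrable (fun s : ℝ => (Real.exp (-1 * s ^ 2) : ℂ) *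
      ((Complex.exp (-Complex.I * (s : ℂ) * (t : ℂ)) - 1) / (s : ℂ))) := by
  refine ((integrable_exp_neg_mul_sq one_pos).const_mul |t|).mono'
    (Measurable.aestronglyMeasurable (by fun_prop)) (Eventually.of_forall fun s => ?_)
  rw [norm_mul, Complex.norm_real, Real.norm_of_nonneg (Real.exp_pos _).le, mul_comm]
  exact mul_le_mul_of_nonneg_right
    (norm_div_le (abs_nonneg t) (norm_exp_phase_sub_one_le s t)) (Real.exp_pos _).le

/-- Differentiation in `t` cancels the factor `1/s` and leaves the Fourier transform of a Gaussian.
-/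
theorem hasDerivAt_gaussOsc (t : ℝ) :
    HasDerivAt gaussOsc (-Complex.I * ((Real.pi : ℂ) ^ (1 / 2 : ℂ) *
      ((Real.exp (-(1 / 4) * t ^ 2) : ℝ) : ℂ))) t := by
  have key := (hasDerivAt_integral_of_dominated_loc_of_deriv_le (μ := volume)
    (F := fun (t : ℝ) (s : ℝ) => (Real.exp (-1 * s ^ 2) : ℂ) *
      ((Complex.exp (-Complex.I * (s : ℂ) * (t : ℂ)) - 1) / (s : ℂ)))
    (F' := fun (t : ℝ) (s : ℝ) => -Complex.I * (Complex.exp (Complex.I * (-t : ℂ) * (s : ℂ)) *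
      Complex.exp (-1 * (s : ℂ) ^ 2)))
    (x₀ := t) (s := Set.univ) (bound := fun s => Real.exp (-1 * s ^ 2)) univ_mem
    (Eventually.of_forall fun t => (integrable_gaussOsc t).aestronglyMeasurable)
    (integrable_gaussOsc t) (Measurable.aestronglyMeasurable (by fun_prop)) ?_
    (integrable_exp_neg_mul_sq one_pos) ?_).2
  · rw [integral_const_mul, fourierIntegral_gaussian (by simp)] at key
    refine HasDerivAt.congr_deriv (f := gaussOsc) key ?_
    rw [div_one]
    push_cast
    congr 3
    ring
  · refine Eventually.of_forall fun s x _ => le_of_eq ?_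
    have e1 : Complex.I * (-x : ℂ) * (s : ℂ) = -Complex.I * (s : ℂ) * (x : ℂ) := by ring
    have e2 : Complex.exp (-1 * (s : ℂ) ^ 2) = ((Real.exp (-1 * s ^ 2) : ℝ) : ℂ) := by
      push_cast; rfl
    rw [norm_mul, norm_mul, e1, norm_exp_phase, e2, Complex.norm_real,
      Real.norm_of_nonneg (Real.exp_pos _).le]
    simp
  · have : ∀ᵐ s : ℝ, s ≠ 0 := Measure.ae_ne volume 0
    filter_upwards [this] with s hs x _
    have hs' : (s : ℂ) ≠ 0 := Complex.ofReal_ne_zero.2 hs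
    have h1 : HasDerivAt (fun x : ℝ => -Complex.I * (s : ℂ) * (x : ℂ)) (-Complex.I * (s : ℂ)) x := by
      simpa using ((hasDerivAt_id x).ofReal_comp).const_mul (-Complex.I * (s : ℂ))
    have h2 := (((h1.cexp).sub_const 1).div_const (s : ℂ)).const_mul (Real.exp (-1 * s ^ 2) : ℂ)
    refine HasDerivAt.congr_deriv h2 ?_
    have e1 : Complex.I * (-x : ℂ) * (s : ℂ) = -Complex.I * (s : ℂ) * (x : ℂ) := by ring
    rw [e1]
    push_cast
    field_simp

/-- Integrating the derivative from `0` gives `-i √π ∫₀^∞ e^{-t²/4} dt = -iπ`. -/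
theorem tendsto_gaussOsc_atTop : Tendsto gaussOsc atTop (𝓝 (-Complex.I * Real.pi)) := by
  have h0 : gaussOsc 0 = 0 := by simp [gaussOsc]
  have hcont : Continuous fun t : ℝ => -Complex.I * ((Real.pi : ℂ) ^ (1 / 2 : ℂ) *
      ((Real.exp (-(1 / 4) * t ^ 2) : ℝ) : ℂ)) := by fun_prop
  have hint : ∀ T : ℝ, gaussOsc T = ∫ t in (0 : ℝ)..T, -Complex.I * ((Real.pi : ℂ) ^ (1 / 2 : ℂ) *
      ((Real.exp (-(1 / 4) * t ^ 2) : ℝ) : ℂ)) := by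
    intro T
    rw [intervalIntegral.integral_eq_sub_of_hasDerivAt (fun t _ => hasDerivAt_gaussOsc t)
      (hcont.intervalIntegrable _ _), h0, sub_zero]
  have hi : Integrable fun t : ℝ => -Complex.I * ((Real.pi : ℂ) ^ (1 / 2 : ℂ) *
      ((Real.exp (-(1 / 4) * t ^ 2) : ℝ) : ℂ)) :=
    (((integrable_exp_neg_mul_sq (by norm_num : (0 : ℝ) < 1 / 4)).ofReal).const_mul _).const_mul _
  have hlim := intervalIntegral_tendsto_integral_Ioi (0 : ℝ) hi.integrableOn tendsto_id
  refine (hlim.congr fun T => (hint T).symm).trans_eq ?_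
  congr 1
  rw [integral_const_mul, integral_const_mul, integral_complex_ofReal, integral_gaussian_Ioi]
  congr 1
  have e1 : (Real.pi : ℂ) ^ (1 / 2 : ℂ) = ((√Real.pi : ℝ) : ℂ) := by
    rw [Real.sqrt_eq_rpow, Complex.ofReal_cpow Real.pi_pos.le]
    norm_num
  have e2 : √(Real.pi / (1 / 4)) = 2 * √Real.pi := by
    rw [show Real.pi / (1 / 4) = 2 ^ 2 * Real.pi by ring, Real.sqrt_mul (by positivity),
      Real.sqrt_sq (by norm_num)]
  rw [e1, e2, ← Complex.ofReal_mul]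
  congr 1
  have := Real.mul_self_sqrt Real.pi_pos.le
  linarith

/-- `∫ (e^{-ist} - 1)/s ds` over `[-m, m]`. -/
noncomputable def boxOsc (m t : ℝ) : ℂ :=
  ∫ s in -m..m, (Complex.exp (-Complex.I * (s : ℂ) * (t : ℂ)) - 1) / (s : ℂ)

theorem boxOsc_neg (m t : ℝ) : boxOsc m (-t) = -boxOsc m t := by
  unfold boxOsc
  have h := intervalIntegral.integral_comp_neg (a := -m) (b := m)
    (fun s : ℝ => (Complex.exp (-Complex.I * (s : ℂ) * ((-t : ℝ) : ℂ)) - 1) / (s : ℂ))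
  rw [neg_neg] at h
  rw [← h, ← intervalIntegral.integral_neg]
  refine intervalIntegral.integral_congr fun s _ => ?_
  simp only [Complex.ofReal_neg, mul_neg, neg_mul, neg_neg, div_neg]

/-- Replacing the Gaussian weight by the indicator of `[-m, m]` changes the integral by `∫ (e^{-ist}
- 1) Q`, where `Q = (1_{[-m,m]} - e^{-s²})/s` is integrable and odd. The `-1` contributes nothing,
and the rest vanishes by Riemann-Lebesgue. -/
theorem tendsto_boxOsc_atTop {m : ℝ} (hm : 0 < m) :
    Tendsto (boxOsc m) atTop (𝓝 (-Complex.I * Real.pi)) := by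
  set Q : ℝ → ℂ := fun s =>
    ((Set.Icc (-m) m).indicator (fun _ => (1 : ℂ)) s - (Real.exp (-1 * s ^ 2) : ℂ)) / (s : ℂ)
    with hQ
  -- Inside the box `1 - e^{-s²} ≤ s² ≤ m |s|`; outside, `|s| ≥ m` bounds the quotient by
  -- `e^{-s²}/m`.
  have hQint : Integrable Q := by
    have hb : Integrable fun s : ℝ => (Set.Icc (-m) m).indicator (fun _ => m) s
        + 1 / m * Real.exp (-1 * s ^ 2) := by
      refine Integrable.add ?_ ((integrable_exp_neg_mul_sq one_pos).const_mul _)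
      exact (integrable_indicator_iff measurableSet_Icc).2 (by simp)
    refine hb.mono' ?_ (Eventually.of_forall fun s => ?_)
    · refine Measurable.aestronglyMeasurable ?_
      exact ((measurable_const.indicator measurableSet_Icc).sub (by fun_prop)).div (by fun_prop)
    · simp only [hQ]
      by_cases hs : s ∈ Set.Icc (-m) m
      · simp only [Set.indicator_of_mem hs]
        have h1 : ‖(1 : ℂ) - (Real.exp (-1 * s ^ 2) : ℂ)‖ ≤ m * |s| := by
          rw [← Complex.ofReal_one, ← Complex.ofReal_sub, Complex.norm_real, Real.norm_eq_abs,
            abs_of_nonneg (by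
              have : Real.exp (-1 * s ^ 2) ≤ 1 := Real.exp_le_one_iff.2 (by nlinarith [sq_nonneg s])
              linarith)]
          have h2 := Real.add_one_le_exp (-1 * s ^ 2)
          have h3 : s ^ 2 ≤ m * |s| := by
            rw [← sq_abs, sq]
            exact mul_le_mul_of_nonneg_right (abs_le.2 hs) (abs_nonneg s)
          linarith
        have := norm_div_le hm.le h1
        have h4 : 0 ≤ 1 / m * Real.exp (-1 * s ^ 2) := by positivity
        linarith
      · simp only [Set.indicator_of_notMem hs, zero_sub, zero_add, norm_div, norm_neg,
          Complex.norm_real, Real.norm_of_nonneg (Real.exp_pos _).le, Real.norm_eq_abs]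
        have hs' : m ≤ |s| := by
          by_contra! h
          exact hs (abs_le.1 h.le)
        rw [one_div_mul_eq_div]
        gcongr
  have hQ0 : ∫ s, Q s = 0 := by
    have h := integral_neg_eq_self Q volume
    have hodd : ∀ s, Q (-s) = -Q s := by
      intro s
      have : (-s ∈ Set.Icc (-m) m) ↔ (s ∈ Set.Icc (-m) m) := by
        simp only [Set.mem_Icc]
        constructor <;> rintro ⟨h1, h2⟩ <;> constructor <;> linarith
      simp only [hQ, Set.indicator_apply, this, neg_sq]
      push_cast
      rw [div_neg]
    simp only [hodd, integral_neg] at h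
    exact self_eq_neg.1 h.symm
  have heq : ∀ t, boxOsc m t = gaussOsc t
      + ∫ s : ℝ, Complex.exp (-Complex.I * (s : ℂ) * (t : ℂ)) * Q s := by
    intro t
    have hi2 : Integrable fun s : ℝ => Complex.exp (-Complex.I * (s : ℂ) * (t : ℂ)) * Q s := by
      refine hQint.mono (AEStronglyMeasurable.mul
        (Measurable.aestronglyMeasurable (by fun_prop)) hQint.aestronglyMeasurable)
        (Eventually.of_forall fun s => ?_)
      rw [norm_mul, norm_exp_phase, one_mul]
    rw [boxOsc, gaussOsc, intervalIntegral.integral_of_le (by linarith),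
      ← integral_Icc_eq_integral_Ioc, ← integral_indicator measurableSet_Icc,
      ← sub_zero (∫ s : ℝ, Complex.exp (-Complex.I * (s : ℂ) * (t : ℂ)) * Q s), ← hQ0,
      ← integral_sub' hi2 hQint, ← integral_add (integrable_gaussOsc t) (hi2.sub hQint)]
    refine integral_congr_ae (Eventually.of_forall fun s => ?_)
    by_cases hs : s ∈ Set.Icc (-m) m
    · simp only [hQ, Set.indicator_of_mem hs, Pi.sub_apply]; ring
    · simp only [hQ, Set.indicator_of_notMem hs, Pi.sub_apply]; ring
  have := tendsto_gaussOsc_atTop.add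
    ((tendsto_integral_exp_mul_cocompact Q).mono_left atTop_le_cocompact)
  rw [add_zero] at this
  exact this.congr fun t => (heq t).symm

/-! ### Decay seminorms of test functions -/

variable {d : ℕ}

/-- The derivative of a test function in the direction of `k⁰`. -/
noncomputable def timeDeriv : 𝓢(Momentum d, ℂ) →L[ℂ] 𝓢(Momentum d, ℂ) :=
  LineDeriv.lineDerivOpCLM ℂ 𝓢(Momentum d, ℂ) ((1, 0) : Momentum d)

theorem hasDerivAt_energyLine (f : 𝓢(Momentum d, ℂ)) (x : ℝ)
    (p : EuclideanSpace ℝ (Fin (d - 1))) :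
    HasDerivAt (fun x : ℝ => f (x, p)) (timeDeriv f (x, p)) x := by
  have h1 : HasDerivAt (fun x : ℝ => ((x, p) : Momentum d)) ((1, 0) : Momentum d) x :=
    (hasDerivAt_id x).prodMk (hasDerivAt_const x p)
  have h2 := (f.hasFDerivAt (x, p)).comp_hasDerivAt x h1
  refine h2.congr_deriv ?_
  rw [timeDeriv, LineDeriv.lineDerivOpCLM_apply, SchwartzMap.lineDerivOp_apply_eq_fderiv]

/-- An integrable weight in the spatial momentum. -/
noncomputable def weight (p : EuclideanSpace ℝ (Fin (d - 1))) : ℝ :=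
  (1 + ‖p‖) ^ (-((d + 2 : ℕ) : ℝ))

theorem weight_nonneg (p : EuclideanSpace ℝ (Fin (d - 1))) : 0 ≤ weight p := by
  unfold weight; positivity

theorem integrable_weight : Integrable (weight (d := d)) := by
  refine integrable_one_add_norm ?_
  rw [finrank_euclideanSpace_fin]
  have : d - 1 < d + 2 := by omega
  exact_mod_cast this

/-- The seminorm that controls the decay of order `d + 2` of a test function. -/
noncomputable def decay (f : 𝓢(Momentum d, ℂ)) : ℝ :=
  2 ^ (d + 2) * ((Finset.Iic (d + 2, 0)).sup fun m => SchwartzMap.seminorm ℂ m.1 m.2) f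

theorem decay_nonneg (f : 𝓢(Momentum d, ℂ)) : 0 ≤ decay f :=
  mul_nonneg (by positivity) (apply_nonneg _ _)

theorem continuous_decay : Continuous (decay (d := d)) := by
  unfold decay
  refine continuous_const.mul ?_
  have h : Continuous fun f => ∑ i ∈ Finset.Iic (d + 2, 0),
      schwartzSeminormFamily ℂ (Momentum d) ℂ i f :=
    continuous_finsetSum _ fun i _ =>
      (schwartz_withSeminorms ℂ (Momentum d) ℂ).continuous_seminorm i
  refine Seminorm.continuous_of_continuousAt_zero ?_
  have h0 := h.tendsto 0
  simp only [map_zero, Finset.sum_const_zero] at h0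
  rw [ContinuousAt, map_zero]
  refine squeeze_zero (fun _ => apply_nonneg _ _) (fun f => ?_) h0
  exact Seminorm.finset_sup_apply_le (Finset.sum_nonneg fun i _ => apply_nonneg _ _) fun i hi =>
    Finset.single_le_sum (f := fun i => schwartzSeminormFamily ℂ (Momentum d) ℂ i f)
      (fun i _ => apply_nonneg _ _) hi

theorem decay_zero : decay (0 : 𝓢(Momentum d, ℂ)) = 0 := by
  simp [decay]

theorem norm_le_decay_mul (f : 𝓢(Momentum d, ℂ)) (k : Momentum d) :
    ‖f k‖ ≤ decay f * (1 + ‖k‖) ^ (-((d + 2 : ℕ) : ℝ)) := by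
  have h := SchwartzMap.one_add_le_sup_seminorm_apply (𝕜 := ℂ) (m := (d + 2, 0)) le_rfl le_rfl f k
  rw [norm_iteratedFDeriv_zero] at h
  rw [Real.rpow_neg (by positivity), Real.rpow_natCast, ← div_eq_mul_inv,
    le_div_iff₀ (by positivity), mul_comm]
  exact h

theorem norm_le_decay_mul_weight (f : 𝓢(Momentum d, ℂ)) (x : ℝ)
    (p : EuclideanSpace ℝ (Fin (d - 1))) : ‖f (x, p)‖ ≤ decay f * weight p := by
  refine (norm_le_decay_mul f (x, p)).trans ?_
  refine mul_le_mul_of_nonneg_left ?_ (decay_nonneg f)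
  refine Real.rpow_le_rpow_of_nonpos (by positivity) ?_ (neg_nonpos.2 (Nat.cast_nonneg _))
  have : ‖p‖ ≤ ‖((x, p) : Momentum d)‖ := norm_snd_le ((x, p) : Momentum d)
  linarith

/-- The sum of the decay seminorms of a test function and its first two energy derivatives. -/
noncomputable def decayTwo (f : 𝓢(Momentum d, ℂ)) : ℝ :=
  decay f + decay (timeDeriv f) + decay (timeDeriv (timeDeriv f))

theorem decayTwo_nonneg (f : 𝓢(Momentum d, ℂ)) : 0 ≤ decayTwo f :=
  add_nonneg (add_nonneg (decay_nonneg _) (decay_nonneg _)) (decay_nonneg _)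

/-- `decayTwo` is continuous and vanishes at `0`, so the bound gives continuity at `0`, which
suffices by linearity. -/
theorem continuous_of_le_decayTwo (T : 𝓢(Momentum d, ℂ) →ₗ[ℂ] ℂ)
    (h : ∃ K, ∀ f, ‖T f‖ ≤ K * decayTwo f) : Continuous T := by
  obtain ⟨K, h⟩ := h
  refine continuous_of_continuousAt_zero T ?_
  have hc : Continuous fun f : 𝓢(Momentum d, ℂ) => K * decayTwo f := by
    unfold decayTwo
    have h1 := continuous_decay (d := d)
    exact continuous_const.mul ((h1.add (h1.comp timeDeriv.continuous)).add
      (h1.comp (timeDeriv.continuous.comp timeDeriv.continuous)))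
  have h0 : Tendsto (fun f : 𝓢(Momentum d, ℂ) => K * decayTwo f) (𝓝 0) (𝓝 0) := by
    have := hc.tendsto 0
    simpa [decayTwo, decay_zero] using this
  rw [ContinuousAt, map_zero]
  exact squeeze_zero_norm h h0

/-- A linear functional on test functions that is bounded by `decayTwo`, as a continuous one. -/
noncomputable def functionalOfDecay (T : 𝓢(Momentum d, ℂ) → ℂ)
    (hadd : ∀ f g, T (f + g) = T f + T g) (hsmul : ∀ (c : ℂ) f, T (c • f) = c * T f)
    (h : ∃ K, ∀ f, ‖T f‖ ≤ K * decayTwo f) : 𝓢(Momentum d, ℂ) →L[ℂ] ℂ where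
  toFun := T
  map_add' := hadd
  map_smul' := hsmul
  cont := continuous_of_le_decayTwo { toFun := T, map_add' := hadd, map_smul' := hsmul } h

/-! ### Test functions on the lines of fixed spatial momentum -/

theorem energy_nonneg (M : ℝ) (p : EuclideanSpace ℝ (Fin (d - 1))) : 0 ≤ energy M p :=
  Real.sqrt_nonneg _

theorem sqrt_le_energy (M : ℝ) (p : EuclideanSpace ℝ (Fin (d - 1))) : √M ≤ energy M p :=
  Real.sqrt_le_sqrt (by nlinarith [sq_nonneg ‖p‖])

theorem le_energy {m : ℝ} (hm : 0 < m) (p : EuclideanSpace ℝ (Fin (d - 1))) :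
    m ≤ energy (m ^ 2) p :=
  (Real.sqrt_sq hm.le).symm.trans_le (sqrt_le_energy (m ^ 2) p)

theorem energy_sq {M : ℝ} (hM : 0 ≤ M) (p : EuclideanSpace ℝ (Fin (d - 1))) :
    energy M p ^ 2 = ‖p‖ ^ 2 + M := Real.sq_sqrt (by positivity)

@[fun_prop]
theorem continuous_energy (M : ℝ) : Continuous (energy (d := d) M) := by
  unfold energy; fun_prop

theorem minkowskiSq_sub {m : ℝ} (k : Momentum d) :
    minkowskiSq k - m ^ 2 = (k.1 - energy (m ^ 2) k.2) * (k.1 + energy (m ^ 2) k.2) := by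
  have := energy_sq (sq_nonneg m) k.2
  unfold minkowskiSq
  linear_combination this

/-- The function `s ↦ f(ω + s, 𝐩) / (s + 2ω)^j` on the line of spatial momentum `𝐩`. -/
noncomputable def fiber (m : ℝ) (j : ℕ) (f : 𝓢(Momentum d, ℂ))
    (p : EuclideanSpace ℝ (Fin (d - 1))) (s : ℝ) : ℂ :=
  f (energy (m ^ 2) p + s, p) * (((s + 2 * energy (m ^ 2) p : ℝ) : ℂ)⁻¹) ^ j

theorem hasDerivAt_fiber {m : ℝ} (j : ℕ) (f : 𝓢(Momentum d, ℂ))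
    {p : EuclideanSpace ℝ (Fin (d - 1))} {s : ℝ} (hs : 0 < s + 2 * energy (m ^ 2) p) :
    HasDerivAt (fiber m j f p)
      (fiber m j (timeDeriv f) p s - j * fiber m (j + 1) f p s) s := by
  have hs' : ((s + 2 * energy (m ^ 2) p : ℝ) : ℂ) ≠ 0 := Complex.ofReal_ne_zero.2 hs.ne'
  have h1 : HasDerivAt (fun s : ℝ => f (energy (m ^ 2) p + s, p))
      (timeDeriv f (energy (m ^ 2) p + s, p)) s :=
    HasDerivAt.comp_const_add _ s (hasDerivAt_energyLine f _ p)
  have h2 : HasDerivAt (fun s : ℝ => ((s + 2 * energy (m ^ 2) p : ℝ) : ℂ)) 1 s := by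
    simpa using ((hasDerivAt_id s).add_const (2 * energy (m ^ 2) p)).ofReal_comp
  have h3 := h1.fun_mul ((h2.fun_inv hs').fun_pow j)
  refine HasDerivAt.congr_deriv h3 ?_
  unfold fiber
  -- The power rule produces the truncated exponent `j - 1`, hence the separate case `j = 0`.
  rcases j with _ | j
  · simp
  · push_cast at hs' ⊢
    rw [div_eq_mul_inv, ← inv_pow]
    ring

theorem pos_of_mem_Icc {m s : ℝ} (hm : 0 < m) (hs : s ∈ Set.Icc (-m) m)
    (p : EuclideanSpace ℝ (Fin (d - 1))) : m ≤ s + 2 * energy (m ^ 2) p := by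
  linarith [hs.1, le_energy hm p]

theorem norm_fiber_le {m s : ℝ} (hm : 0 < m) (hs : s ∈ Set.Icc (-m) m) (j : ℕ)
    (f : 𝓢(Momentum d, ℂ)) (p : EuclideanSpace ℝ (Fin (d - 1))) :
    ‖fiber m j f p s‖ ≤ m⁻¹ ^ j * (decay f * weight p) := by
  have h := pos_of_mem_Icc hm hs p
  rw [fiber, norm_mul, norm_pow, norm_inv, Complex.norm_real, Real.norm_eq_abs,
    abs_of_pos (hm.trans_le h), mul_comm]
  gcongr
  · exact inv_nonneg.2 (hm.trans_le h).le
  · exact norm_le_decay_mul_weight f _ p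

theorem measurable_fiber (m : ℝ) (j : ℕ) (f : 𝓢(Momentum d, ℂ)) :
    Measurable fun x : EuclideanSpace ℝ (Fin (d - 1)) × ℝ => fiber m j f x.1 x.2 := by
  unfold fiber
  have h1 : Continuous fun x : EuclideanSpace ℝ (Fin (d - 1)) × ℝ =>
      f (energy (m ^ 2) x.1 + x.2, x.1) := f.continuous.comp (by fun_prop)
  have h2 : Continuous fun x : EuclideanSpace ℝ (Fin (d - 1)) × ℝ =>
      ((x.2 + 2 * energy (m ^ 2) x.1 : ℝ) : ℂ) := by fun_prop
  exact h1.measurable.mul (h2.measurable.inv.pow_const j)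

theorem continuousOn_fiber {m : ℝ} (hm : 0 < m) (j : ℕ) (f : 𝓢(Momentum d, ℂ))
    (p : EuclideanSpace ℝ (Fin (d - 1))) : ContinuousOn (fiber m j f p) (Set.Icc (-m) m) :=
  fun _ hs => (hasDerivAt_fiber j f
    (hm.trans_le (pos_of_mem_Icc hm hs p))).continuousAt.continuousWithinAt

theorem fiber_add (m : ℝ) (j : ℕ) (f g : 𝓢(Momentum d, ℂ)) (p : EuclideanSpace ℝ (Fin (d - 1)))
    (s : ℝ) : fiber m j (f + g) p s = fiber m j f p s + fiber m j g p s := by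
  simp [fiber, add_mul]

theorem fiber_smul (m : ℝ) (j : ℕ) (c : ℂ) (f : 𝓢(Momentum d, ℂ))
    (p : EuclideanSpace ℝ (Fin (d - 1))) (s : ℝ) :
    fiber m j (c • f) p s = c * fiber m j f p s := by
  simp [fiber, mul_assoc]

/-- The derivative at `s = 0` of `s ↦ f(ω + s, 𝐩) / (s + 2ω)²`. -/
noncomputable def fiberSlope (m : ℝ) (f : 𝓢(Momentum d, ℂ))
    (p : EuclideanSpace ℝ (Fin (d - 1))) : ℂ :=
  fiber m 2 (timeDeriv f) p 0 - 2 * fiber m 3 f p 0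

/-- The constant of the bounds below. -/
noncomputable def fiberConst (m : ℝ) : ℝ := m⁻¹ ^ 2 + 4 * m⁻¹ ^ 3 + 6 * m⁻¹ ^ 4

theorem fiberConst_nonneg {m : ℝ} (hm : 0 < m) : 0 ≤ fiberConst m := by
  unfold fiberConst; positivity

theorem norm_fiber_two_zero_le {m : ℝ} (hm : 0 < m) (f : 𝓢(Momentum d, ℂ))
    (p : EuclideanSpace ℝ (Fin (d - 1))) :
    ‖fiber m 2 f p 0‖ ≤ fiberConst m * (decayTwo f * weight p) := by
  refine (norm_fiber_le hm ⟨by linarith, hm.le⟩ 2 f p).trans ?_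
  have h1 : m⁻¹ ^ 2 ≤ fiberConst m := by
    unfold fiberConst
    have : 0 ≤ 4 * m⁻¹ ^ 3 + 6 * m⁻¹ ^ 4 := by positivity
    linarith
  have h2 : decay f ≤ decayTwo f := by
    unfold decayTwo
    linarith [decay_nonneg (timeDeriv f), decay_nonneg (timeDeriv (timeDeriv f))]
  have := weight_nonneg p
  have := decayTwo_nonneg f
  have := decay_nonneg f
  gcongr
  exact fiberConst_nonneg hm

theorem norm_fiberSlope_le {m : ℝ} (hm : 0 < m) (f : 𝓢(Momentum d, ℂ))
    (p : EuclideanSpace ℝ (Fin (d - 1))) :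
    ‖fiberSlope m f p‖ ≤ fiberConst m * (decayTwo f * weight p) := by
  have h0 : (0 : ℝ) ∈ Set.Icc (-m) m := ⟨by linarith, hm.le⟩
  refine (norm_sub_le _ _).trans ?_
  rw [norm_mul, Complex.norm_ofNat]
  have h1 := norm_fiber_le hm h0 2 (timeDeriv f) p
  have h2 := norm_fiber_le hm h0 3 f p
  have a1 := decay_nonneg f
  have a2 := decay_nonneg (timeDeriv f)
  have a3 := decay_nonneg (timeDeriv (timeDeriv f))
  have a4 := weight_nonneg p
  have a5 : 0 < m⁻¹ := by positivity
  unfold fiberConst decayTwo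
  have e : (m⁻¹ ^ 2 + 4 * m⁻¹ ^ 3 + 6 * m⁻¹ ^ 4) * ((decay f + decay (timeDeriv f)
      + decay (timeDeriv (timeDeriv f))) * weight p)
      = m⁻¹ ^ 2 * (decay (timeDeriv f) * weight p) + 2 * (m⁻¹ ^ 3 * (decay f * weight p))
      + (m⁻¹ ^ 2 * ((decay f + decay (timeDeriv (timeDeriv f))) * weight p)
        + 2 * m⁻¹ ^ 3 * (decay f * weight p)
        + 4 * m⁻¹ ^ 3 * ((decay (timeDeriv f) + decay (timeDeriv (timeDeriv f))) * weight p)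
        + 6 * m⁻¹ ^ 4 * ((decay f + decay (timeDeriv f)
          + decay (timeDeriv (timeDeriv f))) * weight p)) := by ring
  rw [e]
  have : 0 ≤ (m⁻¹ ^ 2 * ((decay f + decay (timeDeriv (timeDeriv f))) * weight p)
        + 2 * m⁻¹ ^ 3 * (decay f * weight p)
        + 4 * m⁻¹ ^ 3 * ((decay (timeDeriv f) + decay (timeDeriv (timeDeriv f))) * weight p)
        + 6 * m⁻¹ ^ 4 * ((decay f + decay (timeDeriv f)
          + decay (timeDeriv (timeDeriv f))) * weight p)) := by positivity
  linarith

/-- The second `s`-derivative of `f/(s + 2ω)²` has coefficients `1`, `-4`, `6` on the inverse powers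
`2`, `3`, `4`. They give the coefficients of `fiberConst`, since `s + 2ω ≥ m` on `[-m, m]`. -/
theorem norm_fiber_remainder_le {m : ℝ} (hm : 0 < m) (f : 𝓢(Momentum d, ℂ))
    (p : EuclideanSpace ℝ (Fin (d - 1))) {s : ℝ} (hs : s ∈ Set.Icc (-m) m) :
    ‖fiber m 2 f p s - fiber m 2 f p 0 - s * fiberSlope m f p‖
      ≤ fiberConst m * (decayTwo f * weight p) * s ^ 2 := by
  have key := norm_taylor_le (m := m) (C := fiberConst m * (decayTwo f * weight p))
    (F := fiber m 2 f p)
    (F1 := fun s => fiber m 2 (timeDeriv f) p s - 2 * fiber m 3 f p s)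
    (F2 := fun s => (fiber m 2 (timeDeriv (timeDeriv f)) p s - 2 * fiber m 3 (timeDeriv f) p s)
      - 2 * (fiber m 3 (timeDeriv f) p s - 3 * fiber m 4 f p s))
    (fun s hs => by
      simpa using hasDerivAt_fiber 2 f (hm.trans_le (pos_of_mem_Icc hm hs p)))
    (fun s hs => by
      have hpos := hm.trans_le (pos_of_mem_Icc hm hs p)
      simpa using (hasDerivAt_fiber 2 (timeDeriv f) hpos).fun_sub
        ((hasDerivAt_fiber 3 f hpos).const_mul 2))
    (fun s hs => by
      have e : (fiber m 2 (timeDeriv (timeDeriv f)) p s - 2 * fiber m 3 (timeDeriv f) p s)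
          - 2 * (fiber m 3 (timeDeriv f) p s - 3 * fiber m 4 f p s)
          = fiber m 2 (timeDeriv (timeDeriv f)) p s - 4 * fiber m 3 (timeDeriv f) p s
            + 6 * fiber m 4 f p s := by ring
      rw [e]
      refine (norm_add_le _ _).trans ((add_le_add_left (norm_sub_le _ _) _).trans ?_)
      rw [norm_mul, norm_mul, Complex.norm_ofNat, Complex.norm_ofNat]
      have h1 := norm_fiber_le hm hs 2 (timeDeriv (timeDeriv f)) p
      have h2 := norm_fiber_le hm hs 3 (timeDeriv f) p
      have h3 := norm_fiber_le hm hs 4 f p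
      have a1 := decay_nonneg f
      have a2 := decay_nonneg (timeDeriv f)
      have a3 := decay_nonneg (timeDeriv (timeDeriv f))
      have a4 := weight_nonneg p
      have a5 : 0 < m⁻¹ := by positivity
      unfold fiberConst decayTwo
      have e : (m⁻¹ ^ 2 + 4 * m⁻¹ ^ 3 + 6 * m⁻¹ ^ 4) * ((decay f + decay (timeDeriv f)
          + decay (timeDeriv (timeDeriv f))) * weight p)
          = m⁻¹ ^ 2 * (decay (timeDeriv (timeDeriv f)) * weight p)
            + 4 * (m⁻¹ ^ 3 * (decay (timeDeriv f) * weight p))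
            + 6 * (m⁻¹ ^ 4 * (decay f * weight p))
          + (m⁻¹ ^ 2 * ((decay f + decay (timeDeriv f)) * weight p)
            + 4 * m⁻¹ ^ 3 * ((decay f + decay (timeDeriv (timeDeriv f))) * weight p)
            + 6 * m⁻¹ ^ 4 * ((decay (timeDeriv f)
              + decay (timeDeriv (timeDeriv f))) * weight p)) := by ring
      rw [e]
      have : 0 ≤ (m⁻¹ ^ 2 * ((decay f + decay (timeDeriv f)) * weight p)
            + 4 * m⁻¹ ^ 3 * ((decay f + decay (timeDeriv (timeDeriv f))) * weight p)
            + 6 * m⁻¹ ^ 4 * ((decay (timeDeriv f)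
              + decay (timeDeriv (timeDeriv f))) * weight p)) := by positivity
      linarith) hs
  exact key

theorem measurable_fiber_apply (m : ℝ) (j : ℕ) (f : 𝓢(Momentum d, ℂ)) (s : ℝ) :
    Measurable fun p : EuclideanSpace ℝ (Fin (d - 1)) => fiber m j f p s :=
  by
  have h := (measurable_fiber m j f).comp
    (measurable_prodMk_right (α := EuclideanSpace ℝ (Fin (d - 1))) (y := s))
  exact h

theorem measurable_fiberSlope (m : ℝ) (f : 𝓢(Momentum d, ℂ)) :
    Measurable (fiberSlope m f) :=
  (measurable_fiber_apply m 2 _ 0).sub ((measurable_fiber_apply m 3 f 0).const_mul 2)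

theorem integrable_of_norm_le_weight {G : EuclideanSpace ℝ (Fin (d - 1)) → ℂ} {K : ℝ}
    (hG : AEStronglyMeasurable G) (h : ∀ p, ‖G p‖ ≤ K * weight p) : Integrable G :=
  (integrable_weight.const_mul K).mono' hG (Eventually.of_forall h)

theorem norm_integral_le_of_norm_le_weight {G : EuclideanSpace ℝ (Fin (d - 1)) → ℂ} {K : ℝ}
    (h : ∀ p, ‖G p‖ ≤ K * weight p) : ‖∫ p, G p‖ ≤ K * ∫ p, weight (d := d) p := by
  refine (norm_integral_le_of_norm_le (integrable_weight.const_mul K)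
    (Eventually.of_forall h)).trans_eq ?_
  rw [integral_const_mul]

theorem integrable_fiberSlope {m : ℝ} (hm : 0 < m) (f : 𝓢(Momentum d, ℂ)) :
    Integrable (fiberSlope m f) :=
  integrable_of_norm_le_weight (K := fiberConst m * decayTwo f)
    (measurable_fiberSlope m f).aestronglyMeasurable
    fun p => (norm_fiberSlope_le hm f p).trans_eq (by ring)

theorem fiberSlope_add (m : ℝ) (f g : 𝓢(Momentum d, ℂ)) (p : EuclideanSpace ℝ (Fin (d - 1))) :
    fiberSlope m (f + g) p = fiberSlope m f p + fiberSlope m g p := by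
  simp only [fiberSlope, map_add, fiber_add]; ring

theorem fiberSlope_smul (m : ℝ) (c : ℂ) (f : 𝓢(Momentum d, ℂ))
    (p : EuclideanSpace ℝ (Fin (d - 1))) :
    fiberSlope m (c • f) p = c * fiberSlope m f p := by
  simp only [fiberSlope, map_smul, fiber_smul]; ring

/-! ### The mass derivative of the shell integral -/

/-- The derivative at `M = m²` of `∫ θ(k⁰) δ(k² - M) f(k) dk`, as a linear functional. -/
noncomputable def shellDeriv {m : ℝ} (hm : 0 < m) : 𝓢(Momentum d, ℂ) →L[ℂ] ℂ :=
  functionalOfDecay (fun f => ∫ p, fiberSlope m f p)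
    (fun f g => by
      simp only [fiberSlope_add]
      exact integral_add (integrable_fiberSlope hm f) (integrable_fiberSlope hm g))
    (fun c f => by
      simp only [fiberSlope_smul]
      exact integral_const_mul _ _)
    ⟨fiberConst m * ∫ p, weight (d := d) p, fun f => by
      have := norm_integral_le_of_norm_le_weight (G := fiberSlope m f)
        (K := fiberConst m * decayTwo f) fun p => (norm_fiberSlope_le hm f p).trans_eq (by ring)
      exact this.trans_eq (by ring)⟩

theorem hasDerivAt_energy {M : ℝ} (hM : 0 < M) (p : EuclideanSpace ℝ (Fin (d - 1))) :
    HasDerivAt (fun M => energy M p) (1 / (2 * energy M p)) M :=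
  ((hasDerivAt_id M).const_add (‖p‖ ^ 2)).sqrt (by simp only [id]; positivity)

theorem energy_pos {M : ℝ} (hM : 0 < M) (p : EuclideanSpace ℝ (Fin (d - 1))) : 0 < energy M p :=
  (Real.sqrt_pos.2 hM).trans_le (sqrt_le_energy M p)

theorem hasDerivAt_shell_integrand (f : 𝓢(Momentum d, ℂ)) {M : ℝ} (hM : 0 < M)
    (p : EuclideanSpace ℝ (Fin (d - 1))) :
    HasDerivAt (fun M => f (energy M p, p) / ((2 * energy M p : ℝ) : ℂ))
      (timeDeriv f (energy M p, p) / ((4 * energy M p ^ 2 : ℝ) : ℂ)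
        - f (energy M p, p) / ((4 * energy M p ^ 3 : ℝ) : ℂ)) M := by
  have hpos := energy_pos hM p
  have hne : (energy M p : ℂ) ≠ 0 := Complex.ofReal_ne_zero.2 hpos.ne'
  have h1 := (hasDerivAt_energyLine f (energy M p) p).scomp M (hasDerivAt_energy hM p)
  have h2 := ((hasDerivAt_energy hM p).const_mul 2).ofReal_comp
  have h3 := h1.fun_div h2 (by push_cast; simpa using hne)
  refine HasDerivAt.congr_deriv h3 ?_
  rw [Complex.real_smul]
  simp only [Function.comp]
  push_cast
  field_simp
  ring

theorem hasDerivAt_shellPos {m : ℝ} (hm : 0 < m) (f : 𝓢(Momentum d, ℂ)) :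
    HasDerivAt (fun M : ℝ => shellPos M f) (shellDeriv hm f) (m ^ 2) := by
  have hm2 : 0 < m ^ 2 := by positivity
  -- A lower bound for the energy valid for all `M > m²/2`, making the domination uniform near `M =
  -- m²`.
  set c : ℝ := √(m ^ 2 / 2) with hc
  have hc0 : 0 < c := Real.sqrt_pos.2 (by positivity)
  have hmeas : ∀ (g : 𝓢(Momentum d, ℂ)) (M : ℝ),
      Continuous fun p : EuclideanSpace ℝ (Fin (d - 1)) => g (energy M p, p) := fun g M =>
    g.continuous.comp (by fun_prop)
  have key := (hasDerivAt_integral_of_dominated_loc_of_deriv_le (μ := volume)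
    (F := fun (M : ℝ) (p : EuclideanSpace ℝ (Fin (d - 1))) =>
      f (energy M p, p) / ((2 * energy M p : ℝ) : ℂ))
    (F' := fun (M : ℝ) (p : EuclideanSpace ℝ (Fin (d - 1))) =>
      timeDeriv f (energy M p, p) / ((4 * energy M p ^ 2 : ℝ) : ℂ)
        - f (energy M p, p) / ((4 * energy M p ^ 3 : ℝ) : ℂ))
    (x₀ := m ^ 2) (s := Set.Ioi (m ^ 2 / 2))
    (bound := fun p => (decay (timeDeriv f) / (4 * c ^ 2) + decay f / (4 * c ^ 3)) * weight p)
    (Ioi_mem_nhds (by linarith))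
    (Eventually.of_forall fun M => ((hmeas f M).measurable.div
      (Measurable.complex_ofReal ((continuous_energy M).measurable.const_mul 2))).aestronglyMeasurable)
    ?_ ?_ ?_ (integrable_weight.const_mul _) ?_).2
  · refine HasDerivAt.congr_deriv (f := fun M : ℝ => shellPos M f) key ?_
    refine integral_congr_ae (Eventually.of_forall fun p => ?_)
    have hne : (energy (m ^ 2) p : ℂ) ≠ 0 := Complex.ofReal_ne_zero.2 (energy_pos hm2 p).ne'
    simp only [fiberSlope, fiber, add_zero, zero_add]
    push_cast
    field_simp
    ring
  · refine integrable_of_norm_le_weight (K := decay f / (2 * m)) ((hmeas f _).measurable.div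
      (Measurable.complex_ofReal
        ((continuous_energy _).measurable.const_mul 2))).aestronglyMeasurable fun p => ?_
    rw [norm_div, Complex.norm_real, Real.norm_of_nonneg (by linarith [energy_pos hm2 p]),
      div_mul_eq_mul_div]
    have h1 := norm_le_decay_mul_weight f (energy (m ^ 2) p) p
    have h2 := le_energy hm p
    have h3 := mul_nonneg (decay_nonneg f) (weight_nonneg p)
    gcongr
  · refine Measurable.aestronglyMeasurable (Measurable.sub
      ((hmeas (timeDeriv f) _).measurable.div (Measurable.complex_ofReal
        (((continuous_energy _).measurable.pow_const 2).const_mul 4)))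
      ((hmeas f _).measurable.div (Measurable.complex_ofReal
        (((continuous_energy _).measurable.pow_const 3).const_mul 4))))
  · refine Eventually.of_forall fun p M hM => ?_
    have hcM : c ≤ energy M p :=
      (Real.sqrt_le_sqrt (le_of_lt hM)).trans (sqrt_le_energy M p)
    refine (norm_sub_le _ _).trans ?_
    rw [norm_div, norm_div, Complex.norm_real, Complex.norm_real,
      Real.norm_of_nonneg (by have := energy_nonneg M p; positivity),
      Real.norm_of_nonneg (by have := energy_nonneg M p; positivity), add_mul,
      div_mul_eq_mul_div, div_mul_eq_mul_div]
    have h1 := norm_le_decay_mul_weight f (energy M p) p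
    have h2 := norm_le_decay_mul_weight (timeDeriv f) (energy M p) p
    have h3 := mul_nonneg (decay_nonneg f) (weight_nonneg p)
    have h4 := mul_nonneg (decay_nonneg (timeDeriv f)) (weight_nonneg p)
    gcongr
  · refine Eventually.of_forall fun p M hM => hasDerivAt_shell_integrand f ?_ p
    have : m ^ 2 / 2 < M := hM
    linarith

/-! ### The principal value on the positive-energy half-space -/

/-- The part of the half-space `k⁰ > 0` where `|k⁰ - ω| ≥ m`. -/
def outerRegion (d : ℕ) (m : ℝ) : Set (Momentum d) :=
  {k | 0 < k.1 ∧ k.1 - energy (m ^ 2) k.2 ∉ Set.Ioc (-m) m}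

theorem measurableSet_outerRegion (m : ℝ) : MeasurableSet (outerRegion d m) := by
  have h1 : Measurable fun k : Momentum d => k.1 := measurable_fst
  have h2 : Measurable fun k : Momentum d => k.1 - energy (m ^ 2) k.2 := by
    have : Continuous fun k : Momentum d => k.1 - energy (m ^ 2) k.2 := by fun_prop
    exact this.measurable
  exact (measurableSet_lt measurable_const h1).inter (h2 measurableSet_Ioc).compl

/-- Both factors of `(k⁰ - ω)(k⁰ + ω)` have modulus at least `m`. A cutoff at `r < m²` therefore
does not touch this region, nor does the support of `φ(k² - m²)` when `ε < m²`. -/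
theorem sq_le_abs_of_mem_outerRegion {m : ℝ} (hm : 0 < m) {k : Momentum d}
    (hk : k ∈ outerRegion d m) : m ^ 2 ≤ |minkowskiSq k - m ^ 2| := by
  obtain ⟨h0, h1⟩ := hk
  have hw := le_energy hm k.2
  rw [minkowskiSq_sub, abs_mul, abs_of_pos (by linarith : 0 < k.1 + energy (m ^ 2) k.2)]
  have h2 : m ≤ |k.1 - energy (m ^ 2) k.2| := by
    by_contra! h
    exact h1 ⟨(abs_lt.1 h).1, (abs_lt.1 h).2.le⟩
  exact (sq m).trans_le (mul_le_mul h2 (by linarith) hm.le (abs_nonneg _))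

instance : (volume : Measure (Momentum d)).IsAddHaarMeasure :=
  Measure.prod.instIsAddHaarMeasure volume volume

theorem integrable_one_add_norm_momentum :
    Integrable fun k : Momentum d => (1 + ‖k‖) ^ (-((d + 2 : ℕ) : ℝ)) := by
  refine integrable_one_add_norm ?_
  rw [Module.finrank_prod, finrank_euclideanSpace_fin, Module.finrank_self]
  have : 1 + (d - 1) < d + 2 := by omega
  exact_mod_cast this

@[fun_prop]
theorem continuous_minkowskiSq : Continuous (minkowskiSq (d := d)) := by
  unfold minkowskiSq; fun_prop

theorem norm_div_minkowski_le {m r : ℝ} (hr : 0 < r) {k : Momentum d}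
    (hk : r ≤ |minkowskiSq k - m ^ 2|) (z : ℂ) :
    ‖z / (((minkowskiSq k - m ^ 2) ^ 2 : ℝ) : ℂ)‖ ≤ (r ^ 2)⁻¹ * ‖z‖ := by
  rw [norm_div, Complex.norm_real, Real.norm_of_nonneg (sq_nonneg _), ← sq_abs, div_eq_inv_mul]
  gcongr

theorem integrableOn_div_minkowski {m r : ℝ} (hr : 0 < r) (f : 𝓢(Momentum d, ℂ))
    {S : Set (Momentum d)} (hS : MeasurableSet S)
    (h : ∀ k ∈ S, r ≤ |minkowskiSq k - m ^ 2|) :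
    IntegrableOn (fun k => f k / (((minkowskiSq k - m ^ 2) ^ 2 : ℝ) : ℂ)) S := by
  refine ((f.integrable (μ := volume)).norm.const_mul (r ^ 2)⁻¹).integrableOn.mono' ?_ ?_
  · have hc : Continuous fun k : Momentum d => (((minkowskiSq k - m ^ 2) ^ 2 : ℝ) : ℂ) := by
      fun_prop
    exact (f.continuous.measurable.div hc.measurable).aestronglyMeasurable
  · exact (ae_restrict_iff' hS).2 (Eventually.of_forall fun k hk =>
      norm_div_minkowski_le hr (h k hk) _)

theorem integrableOn_outerRegion {m : ℝ} (hm : 0 < m) (f : 𝓢(Momentum d, ℂ)) :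
    IntegrableOn (fun k => f k / (((minkowskiSq k - m ^ 2) ^ 2 : ℝ) : ℂ)) (outerRegion d m) :=
  integrableOn_div_minkowski (pow_pos hm 2) f (measurableSet_outerRegion m)
    fun _ hk => sq_le_abs_of_mem_outerRegion hm hk

/-- The finite part of `∫ f(k)/(k² - m²)² dk⁰` over `|k⁰ - ω| ≤ m`, at spatial momentum `𝐩`. -/
noncomputable def fiberPart (m : ℝ) (f : 𝓢(Momentum d, ℂ))
    (p : EuclideanSpace ℝ (Fin (d - 1))) : ℂ :=
  finitePart m (fiber m 2 f p) (fiberSlope m f p)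

theorem stronglyMeasurable_intervalIntegral {m : ℝ} (hm : 0 < m)
    {G : EuclideanSpace ℝ (Fin (d - 1)) × ℝ → ℂ} (hG : Measurable G) :
    StronglyMeasurable fun p => ∫ s in -m..m, G (p, s) := by
  simp only [intervalIntegral.integral_of_le (by linarith : -m ≤ m)]
  exact hG.stronglyMeasurable.integral_prod_right'

theorem stronglyMeasurable_fiberPart {m : ℝ} (hm : 0 < m) (f : 𝓢(Momentum d, ℂ)) :
    StronglyMeasurable (fiberPart m f) := by
  refine StronglyMeasurable.sub ?_ ?_
  · refine stronglyMeasurable_intervalIntegral hm (G := fun x =>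
      (fiber m 2 f x.1 x.2 - fiber m 2 f x.1 0 - x.2 * fiberSlope m f x.1) / (x.2 : ℂ) ^ 2) ?_
    have h1 := measurable_fiber m 2 f
    have h2 : Measurable fun x : EuclideanSpace ℝ (Fin (d - 1)) × ℝ => fiber m 2 f x.1 0 :=
      (measurable_fiber_apply m 2 f 0).comp measurable_fst
    have h3 : Measurable fun x : EuclideanSpace ℝ (Fin (d - 1)) × ℝ => fiberSlope m f x.1 :=
      (measurable_fiberSlope m f).comp measurable_fst
    have h4 : Measurable fun x : EuclideanSpace ℝ (Fin (d - 1)) × ℝ => (x.2 : ℂ) :=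
      Complex.measurable_ofReal.comp measurable_snd
    exact ((h1.sub h2).sub (h4.mul h3)).div (h4.pow_const 2)
  · exact (((measurable_fiber_apply m 2 f 0).const_mul 2).div_const _).stronglyMeasurable

theorem norm_fiberPart_le {m : ℝ} (hm : 0 < m) (f : 𝓢(Momentum d, ℂ))
    (p : EuclideanSpace ℝ (Fin (d - 1))) :
    ‖fiberPart m f p‖ ≤ (2 * m + 2 / m) * fiberConst m * decayTwo f * weight p := by
  have h1 := norm_finitePart_le hm fun s hs => norm_fiber_remainder_le hm f p hs
  have h2 := mul_le_mul_of_nonneg_left (norm_fiber_two_zero_le hm f p)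
    (by positivity : 0 ≤ 2 / m)
  refine h1.trans ((add_le_add_right h2 _).trans_eq ?_)
  ring

theorem integrable_fiberPart {m : ℝ} (hm : 0 < m) (f : 𝓢(Momentum d, ℂ)) :
    Integrable (fiberPart m f) :=
  integrable_of_norm_le_weight (stronglyMeasurable_fiberPart hm f).aestronglyMeasurable
    (norm_fiberPart_le hm f)

theorem fiberPart_add {m : ℝ} (hm : 0 < m) (f g : 𝓢(Momentum d, ℂ))
    (p : EuclideanSpace ℝ (Fin (d - 1))) :
    fiberPart m (f + g) p = fiberPart m f p + fiberPart m g p := by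
  have hi : ∀ h : 𝓢(Momentum d, ℂ), IntervalIntegrable (fun s : ℝ =>
      (fiber m 2 h p s - fiber m 2 h p 0 - s * fiberSlope m h p) / (s : ℂ) ^ 2) volume (-m) m :=
    fun h => intervalIntegrable_remainder hm (continuousOn_fiber hm 2 h p)
      fun s hs => norm_fiber_remainder_le hm h p hs
  have := intervalIntegral.integral_add (hi f) (hi g)
  simp only [fiberPart, finitePart, fiber_add, fiberSlope_add]
  rw [sub_add_sub_comm, ← this]
  congr 1
  · refine intervalIntegral.integral_congr fun s _ => ?_
    ring
  · ring

theorem fiberPart_smul (m : ℝ) (c : ℂ) (f : 𝓢(Momentum d, ℂ))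
    (p : EuclideanSpace ℝ (Fin (d - 1))) :
    fiberPart m (c • f) p = c * fiberPart m f p := by
  simp only [fiberPart, finitePart, fiber_smul, fiberSlope_smul]
  rw [mul_sub, ← intervalIntegral.integral_const_mul]
  congr 1
  · refine intervalIntegral.integral_congr fun s _ => ?_
    ring
  · ring

theorem norm_pvHalf_formula_le {m : ℝ} (hm : 0 < m) (f : 𝓢(Momentum d, ℂ)) :
    ‖(∫ k in outerRegion d m, f k / (((minkowskiSq k - m ^ 2) ^ 2 : ℝ) : ℂ))
      + ∫ p, fiberPart m f p‖
      ≤ (((m ^ 2) ^ 2)⁻¹ * (∫ k : Momentum d, (1 + ‖k‖) ^ (-((d + 2 : ℕ) : ℝ)))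
        + (2 * m + 2 / m) * fiberConst m * ∫ p, weight (d := d) p) * decayTwo f := by
  refine (norm_add_le _ _).trans ?_
  rw [add_mul]
  refine add_le_add ?_ ((norm_integral_le_of_norm_le_weight
    (norm_fiberPart_le hm f)).trans_eq (by ring))
  have hint : Integrable fun k : Momentum d =>
      ((m ^ 2) ^ 2)⁻¹ * (decayTwo f * (1 + ‖k‖) ^ (-((d + 2 : ℕ) : ℝ))) :=
    (integrable_one_add_norm_momentum.const_mul _).const_mul _
  have h1 : ‖∫ k in outerRegion d m, f k / (((minkowskiSq k - m ^ 2) ^ 2 : ℝ) : ℂ)‖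
      ≤ ∫ k in outerRegion d m,
        ((m ^ 2) ^ 2)⁻¹ * (decayTwo f * (1 + ‖k‖) ^ (-((d + 2 : ℕ) : ℝ))) := by
    refine norm_integral_le_of_norm_le hint.integrableOn ?_
    refine (ae_restrict_iff' (measurableSet_outerRegion m)).2 (Eventually.of_forall fun k hk => ?_)
    refine (norm_div_minkowski_le (pow_pos hm 2) (sq_le_abs_of_mem_outerRegion hm hk) _).trans ?_
    refine mul_le_mul_of_nonneg_left ((norm_le_decay_mul f k).trans ?_) (by positivity)
    refine mul_le_mul_of_nonneg_right ?_ (by positivity)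
    unfold decayTwo
    linarith [decay_nonneg (timeDeriv f), decay_nonneg (timeDeriv (timeDeriv f))]
  refine h1.trans ((setIntegral_le_integral hint (Eventually.of_forall fun k => ?_)).trans_eq ?_)
  · have := decayTwo_nonneg f
    positivity
  · rw [integral_const_mul, integral_const_mul]
    ring

/-- The part of `PV 1/(k² - m²)²` that comes from the half-space `k⁰ > 0`, as a functional. -/
noncomputable def pvHalf {m : ℝ} (hm : 0 < m) : 𝓢(Momentum d, ℂ) →L[ℂ] ℂ :=
  functionalOfDecay
    (fun f => (∫ k in outerRegion d m, f k / (((minkowskiSq k - m ^ 2) ^ 2 : ℝ) : ℂ))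
      + ∫ p, fiberPart m f p)
    (fun f g => by
      simp only [fiberPart_add hm, add_apply, add_div]
      rw [integral_add (integrable_fiberPart hm f) (integrable_fiberPart hm g),
        integral_add (integrableOn_outerRegion hm f) (integrableOn_outerRegion hm g)]
      ring)
    (fun c f => by
      simp only [fiberPart_smul, smul_apply, smul_eq_mul, mul_div_assoc, integral_const_mul,
        mul_add])
    ⟨_, norm_pvHalf_formula_le hm⟩

theorem pvHalf_apply {m : ℝ} (hm : 0 < m) (f : 𝓢(Momentum d, ℂ)) :
    pvHalf hm f = (∫ k in outerRegion d m, f k / (((minkowskiSq k - m ^ 2) ^ 2 : ℝ) : ℂ))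
      + ∫ p, fiberPart m f p := rfl

theorem shellDeriv_apply {m : ℝ} (hm : 0 < m) (f : 𝓢(Momentum d, ℂ)) :
    shellDeriv hm f = ∫ p, fiberSlope m f p := rfl

/-- The slab `-m < k⁰ - ω ≤ m` around the positive mass shell. -/
def innerRegion (d : ℕ) (m : ℝ) : Set (Momentum d) :=
  {k | k.1 - energy (m ^ 2) k.2 ∈ Set.Ioc (-m) m}

/-- The complement of a neighbourhood of the mass shells. -/
def offShell (d : ℕ) (m r : ℝ) : Set (Momentum d) := {k | r < |minkowskiSq k - m ^ 2|}

/-- The half-space of positive energies. -/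
def posEnergy (d : ℕ) : Set (Momentum d) := {k | 0 < k.1}

theorem measurableSet_innerRegion (m : ℝ) : MeasurableSet (innerRegion d m) := by
  have h2 : Continuous fun k : Momentum d => k.1 - energy (m ^ 2) k.2 := by fun_prop
  exact h2.measurable measurableSet_Ioc

theorem measurableSet_offShell (m r : ℝ) : MeasurableSet (offShell d m r) := by
  have h2 : Continuous fun k : Momentum d => |minkowskiSq k - m ^ 2| := by fun_prop
  exact measurableSet_lt measurable_const h2.measurable

theorem measurableSet_posEnergy : MeasurableSet (posEnergy d) :=
  measurableSet_lt measurable_const measurable_fst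

theorem minkowskiSq_sub_fiber {m : ℝ} (p : EuclideanSpace ℝ (Fin (d - 1))) (s : ℝ) :
    minkowskiSq ((energy (m ^ 2) p + s, p) : Momentum d) - m ^ 2
      = s * (s + 2 * energy (m ^ 2) p) := by
  rw [minkowskiSq_sub]; ring

theorem integral_slice (m r : ℝ) (f : 𝓢(Momentum d, ℂ)) (p : EuclideanSpace ℝ (Fin (d - 1))) :
    ∫ x : ℝ, (innerRegion d m ∩ offShell d m r).indicator
      (fun k => f k / (((minkowskiSq k - m ^ 2) ^ 2 : ℝ) : ℂ)) (x, p)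
    = ∫ s in {s : ℝ | s ∈ Set.Ioc (-m) m ∧ r < |s * (s + 2 * energy (m ^ 2) p)|},
        fiber m 2 f p s / (s : ℂ) ^ 2 := by
  have hS : MeasurableSet {s : ℝ | s ∈ Set.Ioc (-m) m ∧ r < |s * (s + 2 * energy (m ^ 2) p)|} :=
    measurableSet_Ioc.inter (measurableSet_lt measurable_const
      (show Continuous fun s : ℝ => |s * (s + 2 * energy (m ^ 2) p)| by fun_prop).measurable)
  -- Translation of the energy by `ω` places the pole at `s = 0`.
  rw [← integral_add_left_eq_self _ (energy (m ^ 2) p), ← integral_indicator hS]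
  refine integral_congr_ae (Eventually.of_forall fun s => ?_)
  have hiff : ((energy (m ^ 2) p + s, p) : Momentum d) ∈ innerRegion d m ∩ offShell d m r ↔
      s ∈ {s : ℝ | s ∈ Set.Ioc (-m) m ∧ r < |s * (s + 2 * energy (m ^ 2) p)|} := by
    simp only [Set.mem_inter_iff, innerRegion, offShell, Set.mem_ofPred_eq,
      minkowskiSq_sub_fiber, add_sub_cancel_left]
  by_cases h : s ∈ {s : ℝ | s ∈ Set.Ioc (-m) m ∧ r < |s * (s + 2 * energy (m ^ 2) p)|}
  · simp only [Set.indicator_of_mem h, Set.indicator_of_mem (hiff.2 h)]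
    rw [minkowskiSq_sub_fiber, fiber]
    push_cast
    simp only [div_eq_mul_inv, mul_pow, mul_inv, inv_pow]
    ring
  · simp only [Set.indicator_of_notMem h, Set.indicator_of_notMem (fun h' => h (hiff.1 h'))]

theorem integral_innerRegion {m r : ℝ} (hr : 0 < r) (f : 𝓢(Momentum d, ℂ)) :
    Integrable (fun p : EuclideanSpace ℝ (Fin (d - 1)) =>
      ∫ s in {s : ℝ | s ∈ Set.Ioc (-m) m ∧ r < |s * (s + 2 * energy (m ^ 2) p)|},
        fiber m 2 f p s / (s : ℂ) ^ 2) ∧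
    ∫ k in innerRegion d m ∩ offShell d m r, f k / (((minkowskiSq k - m ^ 2) ^ 2 : ℝ) : ℂ)
      = ∫ p, ∫ s in {s : ℝ | s ∈ Set.Ioc (-m) m ∧ r < |s * (s + 2 * energy (m ^ 2) p)|},
        fiber m 2 f p s / (s : ℂ) ^ 2 := by
  have hM : MeasurableSet (innerRegion d m ∩ offShell d m r) :=
    (measurableSet_innerRegion m).inter (measurableSet_offShell m r)
  have hi := (integrable_indicator_iff hM).2
    (integrableOn_div_minkowski hr f hM fun k hk => le_of_lt hk.2)
  have h1 := Integrable.integral_prod_right hi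
  have h2 := integral_prod_symm _ hi
  simp only [integral_slice] at h1 h2
  exact ⟨h1, (integral_indicator hM).symm.trans h2⟩

/-- The fibrewise cutoff error is `O(r)` times the integrable weight, hence `O(r)` after integration
over `p`. -/
theorem norm_inner_sub_fiberPart_le {m r : ℝ} (hm : 0 < m) (hr : 0 < r) (hrm : r < m ^ 2)
    (f : 𝓢(Momentum d, ℂ)) :
    ‖(∫ k in innerRegion d m ∩ offShell d m r, f k / (((minkowskiSq k - m ^ 2) ^ 2 : ℝ) : ℂ))
      - ((2 / r : ℝ) : ℂ) * shellPos (m ^ 2) f - ∫ p, fiberPart m f p‖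
      ≤ ((1 / m ^ 3 + 2 / m ^ 2 + 2 / m) * (fiberConst m * decayTwo f) * r)
        * ∫ p, weight (d := d) p := by
  obtain ⟨hi, he⟩ := integral_innerRegion (m := m) hr f
  have h0 : (0 : ℝ) ∈ Set.Icc (-m) m := ⟨by linarith, hm.le⟩
  have hs : Integrable fun p => ((2 / r : ℝ) : ℂ) * fiber m 1 f p 0 := by
    refine Integrable.const_mul (integrable_of_norm_le_weight (K := m⁻¹ ^ 1 * decay f)
      (measurable_fiber_apply m 1 f 0).aestronglyMeasurable fun p => ?_) _
    exact (norm_fiber_le hm h0 1 f p).trans_eq (by ring)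
  have hshell : shellPos (m ^ 2) f = ∫ p, fiber m 1 f p 0 := by
    refine integral_congr_ae (Eventually.of_forall fun p => ?_)
    simp only [fiber, add_zero, zero_add, pow_one, div_eq_mul_inv]
  rw [he, hshell, ← integral_const_mul, ← integral_sub' hi hs,
    ← integral_sub' (hi.sub hs) (integrable_fiberPart hm f)]
  refine norm_integral_le_of_norm_le_weight fun p => ?_
  have hw := le_energy hm p
  have key := norm_cutoff_sub_finitePart_le hm hw hr hrm (continuousOn_fiber hm 2 f p)
    fun s hs => norm_fiber_remainder_le hm f p hs
  have hw0 : (energy (m ^ 2) p : ℂ) ≠ 0 := Complex.ofReal_ne_zero.2 (hm.trans_le hw).ne'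
  have hr0 : (r : ℂ) ≠ 0 := Complex.ofReal_ne_zero.2 hr.ne'
  -- The counterterm `(2/r) f/(2ω)` is `4ω F(0)/r`, because `F(0) = f/(4ω²)`.
  have e : ((2 / r : ℝ) : ℂ) * fiber m 1 f p 0
      = 4 * (energy (m ^ 2) p : ℂ) * fiber m 2 f p 0 / r := by
    simp only [fiber, add_zero, zero_add]
    push_cast
    field_simp
    ring
  simp only [Pi.sub_apply]
  rw [e]
  refine key.trans ?_
  have b1 := norm_fiber_two_zero_le hm f p
  have b2 := norm_fiberSlope_le hm f p
  calc _ ≤ ((fiberConst m * (decayTwo f * weight p)) / m ^ 3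
        + 2 * (fiberConst m * (decayTwo f * weight p)) / m ^ 2
        + 2 * (fiberConst m * (decayTwo f * weight p)) / m) * r := by gcongr
    _ = _ := by ring

theorem setIntegral_posEnergy {m r : ℝ} (hm : 0 < m) (hr : 0 < r) (hrm : r < m ^ 2)
    (f : 𝓢(Momentum d, ℂ)) :
    ∫ k in posEnergy d ∩ offShell d m r, f k / (((minkowskiSq k - m ^ 2) ^ 2 : ℝ) : ℂ)
      = (∫ k in outerRegion d m, f k / (((minkowskiSq k - m ^ 2) ^ 2 : ℝ) : ℂ))
        + ∫ k in innerRegion d m ∩ offShell d m r,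
            f k / (((minkowskiSq k - m ^ 2) ^ 2 : ℝ) : ℂ) := by
  have hM : MeasurableSet (innerRegion d m ∩ offShell d m r) :=
    (measurableSet_innerRegion m).inter (measurableSet_offShell m r)
  rw [← setIntegral_union _ hM (integrableOn_outerRegion hm f)
    (integrableOn_div_minkowski hr f hM fun k hk => le_of_lt hk.2)]
  · congr 2
    ext k
    have hw := le_energy hm k.2
    constructor
    · rintro ⟨h1, h2⟩
      by_cases h : k.1 - energy (m ^ 2) k.2 ∈ Set.Ioc (-m) m
      · exact Or.inr ⟨h, h2⟩
      · exact Or.inl ⟨h1, h⟩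
    · rintro (h | ⟨h1, h2⟩)
      · exact ⟨h.1, hrm.trans_le (sq_le_abs_of_mem_outerRegion hm h)⟩
      · refine ⟨?_, h2⟩
        -- Since `ω ≥ m`, the inner slab lies inside `k⁰ > 0`.
        have : -m < k.1 - energy (m ^ 2) k.2 := h1.1
        change 0 < k.1
        linarith
  · rw [Set.disjoint_left]
    rintro k ⟨_, h1⟩ ⟨h2, _⟩
    exact h1 h2

theorem tendsto_posEnergy_cutoff {m : ℝ} (hm : 0 < m) (f : 𝓢(Momentum d, ℂ)) :
    Tendsto (fun r : ℝ =>
      (∫ k in posEnergy d ∩ offShell d m r, f k / (((minkowskiSq k - m ^ 2) ^ 2 : ℝ) : ℂ))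
        - ((2 / r : ℝ) : ℂ) * shellPos (m ^ 2) f) (𝓝[>] 0) (𝓝 (pvHalf hm f)) := by
  rw [tendsto_iff_norm_sub_tendsto_zero]
  have hlim : Tendsto (fun r : ℝ => ((1 / m ^ 3 + 2 / m ^ 2 + 2 / m)
      * (fiberConst m * decayTwo f) * r) * ∫ p, weight (d := d) p) (𝓝[>] 0) (𝓝 0) := by
    refine Tendsto.mono_left ?_ nhdsWithin_le_nhds
    have : Continuous fun r : ℝ => ((1 / m ^ 3 + 2 / m ^ 2 + 2 / m)
      * (fiberConst m * decayTwo f) * r) * ∫ p, weight (d := d) p := by fun_prop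
    simpa using this.tendsto 0
  refine squeeze_zero' (Eventually.of_forall fun _ => norm_nonneg _) ?_ hlim
  have hm2 : 0 < m ^ 2 := by positivity
  filter_upwards [Ioo_mem_nhdsGT hm2] with r hr
  refine le_of_eq_of_le ?_ (norm_inner_sub_fiberPart_le hm hr.1 hr.2 f)
  rw [setIntegral_posEnergy hm hr.1 hr.2, pvHalf_apply]
  congr 1
  ring

/-! ### Reflection of the energy and the three distributions -/

/-- The reflection `k⁰ ↦ -k⁰`. -/
def reflectEquiv (d : ℕ) : Momentum d ≃L[ℝ] Momentum d :=
  (ContinuousLinearEquiv.neg ℝ).prodCongr (ContinuousLinearEquiv.refl ℝ _)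

/-- The action of the reflection `k⁰ ↦ -k⁰` on test functions. -/
noncomputable def reflect : 𝓢(Momentum d, ℂ) →L[ℂ] 𝓢(Momentum d, ℂ) :=
  SchwartzMap.compCLMOfContinuousLinearEquiv ℂ (reflectEquiv d)

theorem reflect_apply (f : 𝓢(Momentum d, ℂ)) (k : Momentum d) : reflect f k = f (-k.1, k.2) := rfl

theorem shellNeg_eq (M : ℝ) (f : 𝓢(Momentum d, ℂ)) : shellNeg M f = shellPos M (reflect f) := rfl

theorem measurePreserving_reflect : MeasurePreserving (fun k : Momentum d => (-k.1, k.2)) :=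
  (Measure.measurePreserving_neg volume).prod (MeasurePreserving.id volume)

theorem setIntegral_offShell {m r : ℝ} (hr : 0 < r) (f : 𝓢(Momentum d, ℂ)) :
    ∫ k in offShell d m r, f k / (((minkowskiSq k - m ^ 2) ^ 2 : ℝ) : ℂ)
      = (∫ k in posEnergy d ∩ offShell d m r, f k / (((minkowskiSq k - m ^ 2) ^ 2 : ℝ) : ℂ))
        + ∫ k in posEnergy d ∩ offShell d m r,
            reflect f k / (((minkowskiSq k - m ^ 2) ^ 2 : ℝ) : ℂ) := by
  set N : Set (Momentum d) := {k | k.1 < 0} ∩ offShell d m r with hN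
  have hNm : MeasurableSet N :=
    (measurableSet_lt measurable_fst measurable_const).inter (measurableSet_offShell m r)
  have hPm : MeasurableSet (posEnergy d ∩ offShell d m r) :=
    measurableSet_posEnergy.inter (measurableSet_offShell m r)
  have hrefl : ∫ k in N, f k / (((minkowskiSq k - m ^ 2) ^ 2 : ℝ) : ℂ)
      = ∫ k in posEnergy d ∩ offShell d m r,
            reflect f k / (((minkowskiSq k - m ^ 2) ^ 2 : ℝ) : ℂ) := by
    have h := measurePreserving_reflect.setIntegral_preimage_emb
      (reflectEquiv d).toHomeomorph.measurableEmbedding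
      (fun k => f k / (((minkowskiSq k - m ^ 2) ^ 2 : ℝ) : ℂ)) N
    rw [← h]
    have hpre : (fun k : Momentum d => ((-k.1, k.2) : Momentum d)) ⁻¹' N
        = posEnergy d ∩ offShell d m r := by
      ext k
      simp [hN, posEnergy, offShell, minkowskiSq]
    rw [hpre]
    refine integral_congr_ae (Eventually.of_forall fun k => ?_)
    simp [reflect_apply, minkowskiSq]
  rw [← hrefl, ← setIntegral_union _ hNm
    (integrableOn_div_minkowski hr f hPm fun k hk => le_of_lt hk.2)
    (integrableOn_div_minkowski hr f hNm fun k hk => le_of_lt hk.2)]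
  · refine setIntegral_congr_set ?_
    have h0 : ∀ᵐ k : Momentum d, k.1 ≠ 0 :=
      Measure.quasiMeasurePreserving_fst.ae (Measure.ae_ne volume (0 : ℝ))
    filter_upwards [h0] with k hk
    refine propext ⟨fun h => ?_, fun h => ?_⟩
    · rcases lt_or_gt_of_ne hk with h1 | h1
      · exact Or.inr ⟨h1, h⟩
      · exact Or.inl ⟨h1, h⟩
    · rcases h with h | h
      · exact h.2
      · exact h.2
  · rw [Set.disjoint_left]
    rintro k ⟨h1, _⟩ ⟨h2, _⟩
    exact lt_asymm (show 0 < k.1 from h1) h2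

/-- The distribution `θ(k⁰) δ'(k² - m²)`. -/
noncomputable def deltaPrimePos {m : ℝ} (hm : 0 < m) : 𝓢'(Momentum d, ℂ) :=
  ContinuousLinearMap.toPointwiseConvergenceCLM _ _ _ _ (-shellDeriv hm)

/-- The distribution `θ(-k⁰) δ'(k² - m²)`. -/
noncomputable def deltaPrimeNeg {m : ℝ} (hm : 0 < m) : 𝓢'(Momentum d, ℂ) :=
  ContinuousLinearMap.toPointwiseConvergenceCLM _ _ _ _ (-(shellDeriv hm).comp reflect)

/-- The distribution `PV 1/(k² - m²)²`. -/
noncomputable def pvInvSq {m : ℝ} (hm : 0 < m) : 𝓢'(Momentum d, ℂ) :=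
  ContinuousLinearMap.toPointwiseConvergenceCLM _ _ _ _ (pvHalf hm + (pvHalf hm).comp reflect)

theorem deltaPrimePos_apply {m : ℝ} (hm : 0 < m) (f : 𝓢(Momentum d, ℂ)) :
    deltaPrimePos hm f = -shellDeriv hm f := rfl

theorem deltaPrimeNeg_apply {m : ℝ} (hm : 0 < m) (f : 𝓢(Momentum d, ℂ)) :
    deltaPrimeNeg hm f = -shellDeriv hm (reflect f) := rfl

theorem pvInvSq_apply {m : ℝ} (hm : 0 < m) (f : 𝓢(Momentum d, ℂ)) :
    pvInvSq hm f = pvHalf hm f + pvHalf hm (reflect f) := rfl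

theorem isDeltaPrimePos_deltaPrimePos {m : ℝ} (hm : 0 < m) :
    IsDeltaPrimePos m (deltaPrimePos (d := d) hm) := fun f => by
  rw [deltaPrimePos_apply, neg_neg]
  exact hasDerivAt_shellPos hm f

theorem isDeltaPrimeNeg_deltaPrimeNeg {m : ℝ} (hm : 0 < m) :
    IsDeltaPrimeNeg m (deltaPrimeNeg (d := d) hm) := fun f => by
  rw [deltaPrimeNeg_apply, neg_neg]
  exact hasDerivAt_shellPos hm (reflect f)

theorem isPVInvSq_pvInvSq {m : ℝ} (hm : 0 < m) :
    IsPVInvSq m (pvInvSq (d := d) hm) := fun f => by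
  rw [pvInvSq_apply]
  refine ((tendsto_posEnergy_cutoff hm f).add (tendsto_posEnergy_cutoff hm (reflect f))).congr' ?_
  filter_upwards [self_mem_nhdsWithin] with r hr
  have h := setIntegral_offShell (m := m) hr f
  rw [offShell] at h
  rw [h, shellNeg_eq]
  simp only [offShell]
  ring

/-! ### The dipole multiplier on one line -/

/-- Agreement at the left endpoint is not required: there `k⁰ = ω - m` may be `0`, where the formula
for the multiplied test function is not available. -/
theorem finitePart_congr {m : ℝ} (hm : 0 < m) {F G : ℝ → ℂ} (c : ℂ)
    (h : ∀ s ∈ Set.Ioc (-m) m, F s = G s) : finitePart m F c = finitePart m G c := by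
  have h0 : F 0 = G 0 := h 0 ⟨by linarith, hm.le⟩
  unfold finitePart
  rw [h0]
  congr 1
  refine intervalIntegral.integral_congr_uIoo fun s hs => ?_
  rw [Set.uIoo_of_le (by linarith)] at hs
  simp only [h s ⟨hs.1, hs.2.le⟩]

theorem hasDerivAt_exp_phase (t s : ℝ) :
    HasDerivAt (fun s : ℝ => Complex.exp (-Complex.I * (s : ℂ) * (t : ℂ)))
      (Complex.exp (-Complex.I * (s : ℂ) * (t : ℂ)) * (-Complex.I * t)) s := by
  have h1 : HasDerivAt (fun s : ℝ => -Complex.I * (s : ℂ) * (t : ℂ)) (-Complex.I * t) s := by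
    simpa using (((hasDerivAt_id s).ofReal_comp).const_mul (-Complex.I)).mul_const (t : ℂ)
  exact h1.cexp

/-- The oscillatory integral to which the dipole multiplier reduces at spatial momentum `𝐩`. -/
noncomputable def oscPart (m t : ℝ) (g : 𝓢(Momentum d, ℂ)) (p : EuclideanSpace ℝ (Fin (d - 1))) :
    ℂ :=
  ∫ s in -m..m, Complex.exp (-Complex.I * (s : ℂ) * (t : ℂ)) *
    ((fiber m 1 (timeDeriv g) p s - fiber m 1 (timeDeriv g) p 0) / (s : ℂ))

theorem norm_fiber_one_sub_le {m : ℝ} (hm : 0 < m) (g : 𝓢(Momentum d, ℂ))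
    (p : EuclideanSpace ℝ (Fin (d - 1))) {s : ℝ} (hs : s ∈ Set.Icc (-m) m) :
    ‖fiber m 1 g p s - fiber m 1 g p 0‖
      ≤ (m⁻¹ * decay (timeDeriv g) + m⁻¹ ^ 2 * decay g) * weight p * |s| := by
  refine norm_sub_le_of_hasDerivAt (F1 := fun s => fiber m 1 (timeDeriv g) p s - fiber m 2 g p s)
    (fun s hs => ?_) (fun s hs => ?_) hs
  · simpa using hasDerivAt_fiber 1 g (hm.trans_le (pos_of_mem_Icc hm hs p))
  · refine (norm_sub_le _ _).trans ?_
    have h1 := norm_fiber_le hm hs 1 (timeDeriv g) p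
    have h2 := norm_fiber_le hm hs 2 g p
    rw [pow_one] at h1
    linarith

/-- The identity `F = B - s B' + s J` absorbs every term proportional to `t` into a total
derivative, so that only a simple pole survives. Its numerator `J` is then split into its phase
times the value of `∂₀g/(2(s + 2ω))` at `s = 0`, and a difference quotient. -/
theorem fiberPart_eq {m t : ℝ} (hm : 0 < m) {g h : 𝓢(Momentum d, ℂ)}
    (hg : ∀ k, m ^ 2 ≤ |minkowskiSq k - m ^ 2| → g k = 0)
    (hh : ∀ k : Momentum d, 0 < k.1 → h k =
      ((k.1 : ℂ) + Complex.I * t / 2 * ((minkowskiSq k - m ^ 2 : ℝ) : ℂ)) *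
        Complex.exp (-Complex.I * ((k.1 - energy (m ^ 2) k.2 : ℝ) : ℂ) * (t : ℂ)) * g k)
    (p : EuclideanSpace ℝ (Fin (d - 1))) :
    fiberPart m h p = 1 / 2 * oscPart m t g p
      + boxOsc m t * (1 / 2 * fiber m 1 (timeDeriv g) p 0) := by
  have hw := le_energy hm p
  set e : ℝ → ℂ := fun s => Complex.exp (-Complex.I * (s : ℂ) * (t : ℂ)) with he
  have hpos : ∀ s ∈ Set.Icc (-m) m, 0 < s + 2 * energy (m ^ 2) p := fun s hs =>
    hm.trans_le (pos_of_mem_Icc hm hs p)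
  set B : ℝ → ℂ := fun s => e s * (1 / 2 * fiber m 1 g p s) with hB
  set B1 : ℝ → ℂ := fun s => e s * (-Complex.I * t) * (1 / 2 * fiber m 1 g p s)
    + e s * (1 / 2 * (fiber m 1 (timeDeriv g) p s - fiber m 2 g p s)) with hB1
  set B2 : ℝ → ℂ := fun s =>
    (e s * (-Complex.I * t) * (-Complex.I * t) * (1 / 2 * fiber m 1 g p s)
      + e s * (-Complex.I * t) * (1 / 2 * (fiber m 1 (timeDeriv g) p s - fiber m 2 g p s)))
    + (e s * (-Complex.I * t) * (1 / 2 * (fiber m 1 (timeDeriv g) p s - fiber m 2 g p s))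
      + e s * (1 / 2 * ((fiber m 1 (timeDeriv (timeDeriv g)) p s - fiber m 2 (timeDeriv g) p s)
        - (fiber m 2 (timeDeriv g) p s - 2 * fiber m 3 g p s)))) with hB2
  set J : ℝ → ℂ := fun s => e s * (1 / 2 * fiber m 1 (timeDeriv g) p s) with hJ
  set J1 : ℝ → ℂ := fun s => e s * (-Complex.I * t) * (1 / 2 * fiber m 1 (timeDeriv g) p s)
    + e s * (1 / 2 * (fiber m 1 (timeDeriv (timeDeriv g)) p s - fiber m 2 (timeDeriv g) p s))
    with hJ1
  have d1 : ∀ f : 𝓢(Momentum d, ℂ), ∀ s ∈ Set.Icc (-m) m, HasDerivAt (fiber m 1 f p)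
      (fiber m 1 (timeDeriv f) p s - fiber m 2 f p s) s := fun f s hs => by
    simpa using hasDerivAt_fiber 1 f (hpos s hs)
  have d2 : ∀ f : 𝓢(Momentum d, ℂ), ∀ s ∈ Set.Icc (-m) m, HasDerivAt (fiber m 2 f p)
      (fiber m 2 (timeDeriv f) p s - 2 * fiber m 3 f p s) s := fun f s hs => by
    simpa using hasDerivAt_fiber 2 f (hpos s hs)
  have hBd : ∀ s ∈ Set.Icc (-m) m, HasDerivAt B (B1 s) s := fun s hs =>
    (hasDerivAt_exp_phase t s).fun_mul ((d1 g s hs).const_mul (1 / 2))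
  have hB1d : ∀ s ∈ Set.Icc (-m) m, HasDerivAt B1 (B2 s) s := fun s hs =>
    (((hasDerivAt_exp_phase t s).mul_const (-Complex.I * t)).fun_mul
      ((d1 g s hs).const_mul (1 / 2))).fun_add ((hasDerivAt_exp_phase t s).fun_mul
        (((d1 (timeDeriv g) s hs).fun_sub (d2 g s hs)).const_mul (1 / 2)))
  have hJd : ∀ s ∈ Set.Icc (-m) m, HasDerivAt J (J1 s) s := fun s hs =>
    (hasDerivAt_exp_phase t s).fun_mul ((d1 (timeDeriv g) s hs).const_mul (1 / 2))
  have hec : ContinuousOn e (Set.Icc (-m) m) := by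
    have : Continuous e := by fun_prop
    exact this.continuousOn
  have fc : ∀ (j : ℕ) (f : 𝓢(Momentum d, ℂ)), ContinuousOn (fiber m j f p) (Set.Icc (-m) m) :=
    fun j f => continuousOn_fiber hm j f p
  have c1 := fc 1 g
  have c2 := fc 2 g
  have c3 := fc 3 g
  have c4 := fc 1 (timeDeriv g)
  have c5 := fc 2 (timeDeriv g)
  have c6 := fc 1 (timeDeriv (timeDeriv g))
  obtain ⟨C, hC⟩ := isCompact_Icc.exists_bound_of_continuousOn
    (show ContinuousOn B2 (Set.Icc (-m) m) by fun_prop)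
  obtain ⟨D, hD⟩ := isCompact_Icc.exists_bound_of_continuousOn
    (show ContinuousOn J1 (Set.Icc (-m) m) by fun_prop)
  -- For `|s| ≥ m` and `k⁰ ≥ 0` one has `|k² - m²| ≥ m²`, where `g` vanishes; this supplies the
  -- boundary values of `B`.
  have hgz : ∀ s : ℝ, m ≤ |s| → 0 ≤ s + energy (m ^ 2) p → g (energy (m ^ 2) p + s, p) = 0 := by
    intro s hs hs'
    refine hg _ ?_
    rw [minkowskiSq_sub_fiber, abs_mul, abs_of_nonneg (by linarith : 0 ≤ s + 2 * energy (m ^ 2) p)]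
    exact (sq m).trans_le (mul_le_mul hs (by linarith) hm.le (abs_nonneg s))
  have hBm : B m = 0 := by
    simp only [hB, fiber, hgz m (le_abs_self m) (by linarith)]
    ring
  have hBm' : B (-m) = 0 := by
    simp only [hB, fiber, hgz (-m) (by rw [abs_neg]; exact le_abs_self m) (by linarith)]
    ring
  have hJc : ContinuousOn J (Set.Icc (-m) m) := fun s hs =>
    (hJd s hs).continuousAt.continuousWithinAt
  have hJl : ∀ s ∈ Set.Icc (-m) m, ‖J s - J 0‖ ≤ D * |s| := fun s hs =>
    norm_sub_le_of_hasDerivAt hJd hD hs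
  have hparts := finitePart_by_parts hm hBd hB1d hC hBm hBm' hJc hJl
  have hF : ∀ s ∈ Set.Ioc (-m) m, fiber m 2 h p s = B s - s * B1 s + s * J s := by
    intro s hs
    have hne : ((s + 2 * energy (m ^ 2) p : ℝ) : ℂ) ≠ 0 :=
      Complex.ofReal_ne_zero.2 (hpos s ⟨hs.1.le, hs.2⟩).ne'
    have h1 := hh (energy (m ^ 2) p + s, p) (by simp only; linarith [hs.1])
    rw [minkowskiSq_sub_fiber] at h1
    simp only [add_sub_cancel_left] at h1
    simp only [hB, hB1, hJ, fiber, h1, he]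
    push_cast at hne ⊢
    field_simp
    ring
  have h0 : (0 : ℝ) ∈ Set.Icc (-m) m := ⟨by linarith, hm.le⟩
  -- Both sides are derivatives at `0` of the same function. In `(B - s B' + s J)'(0)` the terms in
  -- `B'(0)` cancel.
  have hslope : fiberSlope m h p = J 0 := by
    have s1 : HasDerivAt (fiber m 2 h p) (fiberSlope m h p) 0 := d2 h 0 h0
    have s2 : HasDerivAt (fun s : ℝ => B s - s * B1 s + s * J s)
        (B1 0 - (1 * B1 0 + ((0 : ℝ) : ℂ) * B2 0) + (1 * J 0 + ((0 : ℝ) : ℂ) * J1 0)) 0 := by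
      have hid : HasDerivAt (fun s : ℝ => (s : ℂ)) 1 0 := by
        simpa using (hasDerivAt_id (0 : ℝ)).ofReal_comp
      exact ((hBd 0 h0).fun_sub (hid.fun_mul (hB1d 0 h0))).fun_add (hid.fun_mul (hJd 0 h0))
    have s3 := s2.congr_of_eventuallyEq (f₁ := fiber m 2 h p)
      (by filter_upwards [Ioo_mem_nhds (show -m < 0 by linarith) hm] with s hs
          exact hF s ⟨hs.1, hs.2.le⟩)
    rw [s1.unique s3]
    push_cast
    ring
  have hJ0 : J 0 = 1 / 2 * fiber m 1 (timeDeriv g) p 0 := by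
    simp [hJ, he]
  have i1 : IntervalIntegrable (fun s : ℝ => 1 / 2 * (e s *
      ((fiber m 1 (timeDeriv g) p s - fiber m 1 (timeDeriv g) p 0) / (s : ℂ)))) volume (-m) m := by
    have := intervalIntegrable_diffQuot hm c4 fun s hs => norm_fiber_one_sub_le hm (timeDeriv g) p hs
    refine (this.continuousOn_mul ?_).const_mul _
    rwa [Set.uIcc_of_le (by linarith)]
  have i2 : IntervalIntegrable (fun s : ℝ => (e s - 1) / (s : ℂ) *
      (1 / 2 * fiber m 1 (timeDeriv g) p 0)) volume (-m) m := by
    have he0 : e 0 = 1 := by simp [he]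
    have := intervalIntegrable_diffQuot (J := e) (D := |t|) hm hec fun s _ => by
      rw [he0]; exact norm_exp_phase_sub_one_le s t
    rw [he0] at this
    exact this.mul_const _
  rw [fiberPart, hslope, finitePart_congr hm _ hF, hparts, oscPart, boxOsc,
    ← intervalIntegral.integral_const_mul, ← intervalIntegral.integral_mul_const,
    ← intervalIntegral.integral_add i1 i2]
  refine intervalIntegral.integral_congr fun s _ => ?_
  simp only [hJ0]
  simp only [hJ]
  ring

theorem pvHalf_eq {m t : ℝ} (hm : 0 < m) {g h : 𝓢(Momentum d, ℂ)}
    (hg : ∀ k, m ^ 2 ≤ |minkowskiSq k - m ^ 2| → g k = 0)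
    (hh : ∀ k : Momentum d, 0 < k.1 → h k =
      ((k.1 : ℂ) + Complex.I * t / 2 * ((minkowskiSq k - m ^ 2 : ℝ) : ℂ)) *
        Complex.exp (-Complex.I * ((k.1 - energy (m ^ 2) k.2 : ℝ) : ℂ) * (t : ℂ)) * g k) :
    pvHalf hm h = ∫ p, (1 / 2 * oscPart m t g p
      + boxOsc m t * (1 / 2 * fiber m 1 (timeDeriv g) p 0)) := by
  rw [pvHalf_apply]
  have : ∫ k in outerRegion d m, h k / (((minkowskiSq k - m ^ 2) ^ 2 : ℝ) : ℂ) = 0 := by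
    refine setIntegral_eq_zero_of_forall_eq_zero fun k hk => ?_
    rw [hh k hk.1, hg k (sq_le_abs_of_mem_outerRegion hm hk), mul_zero, zero_div]
  rw [this, zero_add]
  exact integral_congr_ae (Eventually.of_forall fun p => fiberPart_eq hm hg hh p)

theorem norm_oscPart_le {m : ℝ} (hm : 0 < m) (t : ℝ) (g : 𝓢(Momentum d, ℂ))
    (p : EuclideanSpace ℝ (Fin (d - 1))) :
    ‖oscPart m t g p‖ ≤ 2 * m * (m⁻¹ * decay (timeDeriv (timeDeriv g))
      + m⁻¹ ^ 2 * decay (timeDeriv g)) * weight p := by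
  have hK : 0 ≤ (m⁻¹ * decay (timeDeriv (timeDeriv g)) + m⁻¹ ^ 2 * decay (timeDeriv g))
      * weight p := by
    have := decay_nonneg (timeDeriv (timeDeriv g))
    have := decay_nonneg (timeDeriv g)
    have := weight_nonneg p
    positivity
  refine (intervalIntegral.norm_integral_le_of_norm_le_const
    (C := (m⁻¹ * decay (timeDeriv (timeDeriv g)) + m⁻¹ ^ 2 * decay (timeDeriv g)) * weight p)
    fun s hs => ?_).trans_eq ?_
  · rw [Set.uIoc_of_le (by linarith)] at hs
    rw [norm_mul, norm_exp_phase, one_mul]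
    exact norm_div_le hK (norm_fiber_one_sub_le hm (timeDeriv g) p ⟨hs.1.le, hs.2⟩)
  · rw [abs_of_pos (by linarith)]
    ring

theorem stronglyMeasurable_oscPart {m : ℝ} (hm : 0 < m) (t : ℝ) (g : 𝓢(Momentum d, ℂ)) :
    StronglyMeasurable (oscPart m t g) := by
  refine stronglyMeasurable_intervalIntegral hm (G := fun x =>
    Complex.exp (-Complex.I * (x.2 : ℂ) * (t : ℂ)) *
      ((fiber m 1 (timeDeriv g) x.1 x.2 - fiber m 1 (timeDeriv g) x.1 0) / (x.2 : ℂ))) ?_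
  have h1 := measurable_fiber m 1 (timeDeriv g)
  have h2 : Measurable fun x : EuclideanSpace ℝ (Fin (d - 1)) × ℝ =>
      fiber m 1 (timeDeriv g) x.1 0 := (measurable_fiber_apply m 1 (timeDeriv g) 0).comp measurable_fst
  have h4 : Measurable fun x : EuclideanSpace ℝ (Fin (d - 1)) × ℝ => (x.2 : ℂ) :=
    Complex.measurable_ofReal.comp measurable_snd
  exact (Complex.measurable_exp.comp ((h4.const_mul _).mul_const _)).mul ((h1.sub h2).div h4)

/-- Riemann-Lebesgue for each `p`, then dominated convergence with a majorant independent of `t`.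
The filter is kept general because both signs of time are needed. -/
theorem tendsto_integral_oscPart {m : ℝ} (hm : 0 < m) (g : 𝓢(Momentum d, ℂ)) {l : Filter ℝ}
    [l.IsCountablyGenerated] (hl : l ≤ cocompact ℝ) :
    Tendsto (fun t => ∫ p, 1 / 2 * oscPart m t g p) l (𝓝 0) := by
  simp only [integral_const_mul]
  have key := tendsto_integral_filter_of_dominated_convergence (l := l) (μ := volume)
    (F := fun t => oscPart m t g) (f := fun _ : EuclideanSpace ℝ (Fin (d - 1)) => (0 : ℂ))
    (fun p => 2 * m * (m⁻¹ * decay (timeDeriv (timeDeriv g))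
      + m⁻¹ ^ 2 * decay (timeDeriv g)) * weight p)
    (Eventually.of_forall fun t => (stronglyMeasurable_oscPart hm t g).aestronglyMeasurable)
    (Eventually.of_forall fun t => Eventually.of_forall fun p => norm_oscPart_le hm t g p)
    (integrable_weight.const_mul _)
    (Eventually.of_forall fun p =>
      (tendsto_intervalIntegral_exp_mul_cocompact hm _).mono_left hl)
  rw [integral_zero] at key
  simpa only [mul_zero] using key.const_mul (1 / 2)

/-- Near the shell `g = f/k⁰`, and `∂₀(f/k⁰)/(4ω) = ∂₀f/(4ω²) - f/(4ω³)` at `k⁰ = ω`. This is where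
the mass derivative, and so `δ'`, enters the limit. -/
theorem half_fiber_timeDeriv_eq {m δ : ℝ} (hm : 0 < m) (hδ : 0 < δ) {f g : 𝓢(Momentum d, ℂ)}
    (hgf : ∀ k : Momentum d, 0 < k.1 → |minkowskiSq k - m ^ 2| < δ → g k = f k / (k.1 : ℂ))
    (p : EuclideanSpace ℝ (Fin (d - 1))) :
    1 / 2 * fiber m 1 (timeDeriv g) p 0 = fiberSlope m f p := by
  have hw : 0 < energy (m ^ 2) p := hm.trans_le (le_energy hm p)
  have hw0 : (energy (m ^ 2) p : ℂ) ≠ 0 := Complex.ofReal_ne_zero.2 hw.ne'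
  have hu : Continuous fun x : ℝ => |minkowskiSq ((x, p) : Momentum d) - m ^ 2| := by fun_prop
  have hu0 : |minkowskiSq ((energy (m ^ 2) p, p) : Momentum d) - m ^ 2| < δ := by
    rw [minkowskiSq_sub]; simpa using hδ
  have h1 : HasDerivAt (fun x : ℝ => f (x, p) / (x : ℂ)) _ (energy (m ^ 2) p) :=
    (hasDerivAt_energyLine f _ p).fun_div ((hasDerivAt_id (energy (m ^ 2) p)).ofReal_comp) hw0
  have h2 := h1.congr_of_eventuallyEq (f₁ := fun x : ℝ => g (x, p)) (by
    filter_upwards [lt_mem_nhds hw, hu.continuousAt.eventually_lt continuousAt_const hu0] with x hx hx'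
    exact hgf (x, p) hx hx')
  have h3 := (hasDerivAt_energyLine g _ p).unique h2
  simp only [fiberSlope, fiber, add_zero, zero_add, h3, Complex.ofReal_one]
  push_cast
  field_simp

theorem tendsto_pvHalf {m δ : ℝ} (hm : 0 < m) (hδ : 0 < δ) {f g : 𝓢(Momentum d, ℂ)}
    {h : ℝ → 𝓢(Momentum d, ℂ)}
    (hg : ∀ k, m ^ 2 ≤ |minkowskiSq k - m ^ 2| → g k = 0)
    (hgf : ∀ k : Momentum d, 0 < k.1 → |minkowskiSq k - m ^ 2| < δ → g k = f k / (k.1 : ℂ))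
    (hh : ∀ (t : ℝ) (k : Momentum d), 0 < k.1 → h t k =
      ((k.1 : ℂ) + Complex.I * t / 2 * ((minkowskiSq k - m ^ 2 : ℝ) : ℂ)) *
        Complex.exp (-Complex.I * ((k.1 - energy (m ^ 2) k.2 : ℝ) : ℂ) * (t : ℂ)) * g k)
    {l : Filter ℝ} [l.IsCountablyGenerated] (hl : l ≤ cocompact ℝ) {L : ℂ}
    (hL : Tendsto (boxOsc m) l (𝓝 L)) :
    Tendsto (fun t => pvHalf hm (h t)) l (𝓝 (L * shellDeriv hm f)) := by
  have heq : ∀ t, pvHalf hm (h t) = (∫ p, 1 / 2 * oscPart m t g p)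
      + boxOsc m t * shellDeriv hm f := by
    intro t
    rw [pvHalf_eq hm hg (hh t), shellDeriv_apply, ← integral_const_mul, ← integral_add]
    · simp only [half_fiber_timeDeriv_eq hm hδ hgf]
    · exact (integrable_of_norm_le_weight
        (stronglyMeasurable_oscPart hm t g).aestronglyMeasurable
        (norm_oscPart_le hm t g)).const_mul _
    · exact (integrable_fiberSlope hm f).const_mul _
  simp only [heq]
  simpa using (tendsto_integral_oscPart hm g hl).add (hL.mul_const (shellDeriv hm f))

theorem tendsto_boxOsc_atBot {m : ℝ} (hm : 0 < m) :
    Tendsto (boxOsc m) atBot (𝓝 (Complex.I * Real.pi)) := by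
  have h := ((tendsto_boxOsc_atTop hm).comp tendsto_neg_atBot_atTop).neg
  simp only [Function.comp_def, boxOsc_neg, neg_neg, neg_mul] at h
  exact h

/-! ### Smoothness and temperate growth of the multipliers -/

theorem exists_smooth_inv_cutoff {a : ℝ} (ha : 0 < a) (ha2 : a < 2) :
    ∃ τ : ℝ → ℝ, τ.HasTemperateGrowth ∧ (∀ v ≤ 0, τ v = 0) ∧
      ∀ v, a ≤ v → v ≤ 2 → τ v = v⁻¹ := by
  -- The inner ball is exactly `[a, 2]`, and the outer one starts at `a/2 > 0`, away from the pole
  -- of `v⁻¹`.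
  let b : ContDiffBump (a / 2 + 1 : ℝ) := ⟨1 - a / 2, 1, by linarith, by linarith⟩
  have hb0 : ∀ v ≤ a / 2, b v = 0 := fun v hv => b.zero_of_le_dist (by
    rw [Real.dist_eq, abs_of_nonpos (by linarith)]
    change (1 : ℝ) ≤ _
    linarith)
  refine ⟨fun v => b v * v⁻¹, ?_, fun v hv => ?_, fun v h1 h2 => ?_⟩
  · refine HasCompactSupport.hasTemperateGrowth b.hasCompactSupport.mul_right ?_
    refine contDiff_iff_contDiffAt.2 fun v => ?_
    rcases lt_or_ge 0 v with hv | hv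
    · exact b.contDiffAt.mul (contDiffAt_inv ℝ hv.ne')
    · refine (contDiffAt_const (c := (0 : ℝ))).congr_of_eventuallyEq ?_
      filter_upwards [Iio_mem_nhds (show v < a / 2 by linarith)] with x hx
      rw [hb0 x (le_of_lt hx), zero_mul]
  · simp only [hb0 v (by linarith), zero_mul]
  · have : b v = 1 := b.one_of_mem_closedBall (by
      rw [Metric.mem_closedBall, Real.dist_eq, abs_le]
      change -(1 - a / 2) ≤ _ ∧ _ ≤ 1 - a / 2
      constructor <;> linarith)
    simp only [this, one_mul]

/-- `ω = m (1 + |p/m|²)^{1/2}`, so every real power of `ω` is a rescaled power of `1 + |p|²`. -/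
theorem hasTemperateGrowth_energy_rpow {m : ℝ} (hm : 0 < m) (r : ℝ) :
    (fun k : Momentum d => energy (m ^ 2) k.2 ^ r).HasTemperateGrowth := by
  have h1 := Function.hasTemperateGrowth_one_add_norm_sq_rpow
    (EuclideanSpace ℝ (Fin (d - 1))) (r / 2)
  have h2 := (m⁻¹ • ContinuousLinearMap.snd ℝ ℝ (EuclideanSpace ℝ (Fin (d - 1)))).hasTemperateGrowth
  have h3 := (Function.HasTemperateGrowth.const (E := Momentum d) (m ^ r)).mul (h1.comp h2)
  refine (congrArg Function.HasTemperateGrowth (funext fun k => ?_)).mpr h3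
  have e : energy (m ^ 2) k.2 = m * (1 + ‖m⁻¹ • k.2‖ ^ 2) ^ (1 / 2 : ℝ) := by
    rw [← Real.sqrt_eq_rpow, energy, norm_smul, Real.norm_of_nonneg (by positivity)]
    conv_rhs => rw [← Real.sqrt_sq hm.le, ← Real.sqrt_mul (by positivity)]
    congr 1
    rw [Real.sqrt_sq hm.le]
    field_simp
    ring
  rw [e, Real.mul_rpow hm.le (by positivity), ← Real.rpow_mul (by positivity)]
  simp only [Pi.mul_apply, Function.comp_apply]
  rw [one_div_mul_eq_div]
  rfl

theorem hasTemperateGrowth_energy {m : ℝ} (hm : 0 < m) :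
    (fun k : Momentum d => energy (m ^ 2) k.2).HasTemperateGrowth := by
  simpa using hasTemperateGrowth_energy_rpow (d := d) hm 1

theorem hasTemperateGrowth_inv_energy {m : ℝ} (hm : 0 < m) :
    (fun k : Momentum d => (energy (m ^ 2) k.2)⁻¹).HasTemperateGrowth := by
  have := hasTemperateGrowth_energy_rpow (d := d) hm (-1)
  simpa only [Real.rpow_neg_one] using this

theorem hasTemperateGrowth_fst : (fun k : Momentum d => k.1).HasTemperateGrowth :=
  (ContinuousLinearMap.fst ℝ ℝ (EuclideanSpace ℝ (Fin (d - 1)))).hasTemperateGrowth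

theorem hasTemperateGrowth_minkowskiSq_sub (m : ℝ) :
    (fun k : Momentum d => minkowskiSq k - m ^ 2).HasTemperateGrowth := by
  have h1 := (hasTemperateGrowth_fst (d := d)).pow 2
  have h2 := (Function.hasTemperateGrowth_norm_sq (EuclideanSpace ℝ (Fin (d - 1)))).comp
    (ContinuousLinearMap.snd ℝ ℝ (EuclideanSpace ℝ (Fin (d - 1)))).hasTemperateGrowth
  exact (h1.sub h2).sub (Function.HasTemperateGrowth.const (m ^ 2))

theorem hasTemperateGrowth_ofReal {ψ : Momentum d → ℝ} (hψ : ψ.HasTemperateGrowth) :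
    (fun k => (ψ k : ℂ)).HasTemperateGrowth :=
  Function.Complex.hasTemperateGrowth_ofReal.comp hψ

/-- The `n`-th derivative has constant modulus `|t|^n`. -/
theorem hasTemperateGrowth_exp_phase (t : ℝ) :
    (fun s : ℝ => Complex.exp (-Complex.I * (s : ℂ) * (t : ℂ))).HasTemperateGrowth := by
  have hd : ∀ n : ℕ, iteratedDeriv n (fun s : ℝ => Complex.exp (-Complex.I * (s : ℂ) * (t : ℂ)))
      = fun s : ℝ => Complex.exp (-Complex.I * (s : ℂ) * (t : ℂ)) * (-Complex.I * t) ^ n := by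
    intro n
    induction n with
    | zero => simp
    | succ n ih =>
      rw [iteratedDeriv_succ, ih]
      ext s
      rw [((hasDerivAt_exp_phase t s).mul_const _).deriv]
      ring
  refine ⟨?_, fun n => ⟨0, |t| ^ n, fun s => ?_⟩⟩
  · exact ((contDiff_const.mul Complex.ofRealCLM.contDiff).mul contDiff_const).cexp
  rw [norm_iteratedFDeriv_eq_norm_iteratedDeriv, hd, norm_mul, norm_exp_phase]
  simp

theorem hasTemperateGrowth_exp_phase_comp {ψ : Momentum d → ℝ} (hψ : ψ.HasTemperateGrowth)
    (t : ℝ) : (fun k => Complex.exp (-Complex.I * (ψ k : ℂ) * (t : ℂ))).HasTemperateGrowth :=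
  (hasTemperateGrowth_exp_phase t).comp hψ

theorem hasTemperateGrowth_reflect {ψ : Momentum d → ℂ} (hψ : ψ.HasTemperateGrowth) :
    (fun k : Momentum d => ψ (-k.1, k.2)).HasTemperateGrowth :=
  hψ.comp (reflectEquiv d).hasTemperateGrowth

/-- A smooth version of `θ(k⁰) φ(k² - m²) / k⁰`. -/
theorem exists_cutoff_div_energy {m ε : ℝ} (hm : 0 < m) (hε0 : 0 < ε)
    (hε : ε < m ^ 2)
    {φ : ℝ → ℝ} (hφ : ContDiff ℝ ∞ φ) (hs : tsupport φ ⊆ Set.Ioo (-ε) ε) :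
    ∃ η : Momentum d → ℂ, η.HasTemperateGrowth ∧ (∀ k, k.1 ≤ 0 → η k = 0) ∧
      (∀ k, 0 < k.1 → η k = (φ (minkowskiSq k - m ^ 2) : ℂ) / (k.1 : ℂ)) := by
  have hφT : φ.HasTemperateGrowth := HasCompactSupport.hasTemperateGrowth
    (isCompact_Icc.of_isClosed_subset (isClosed_tsupport φ) (hs.trans Set.Ioo_subset_Icc_self)) hφ
  have hm2 : 0 < m ^ 2 := by positivity
  -- On the support of `φ(k² - m²)` with `k⁰ > 0` one has `(k⁰/ω)² ≥ 1 - ε/m² = a²` and `k⁰ ≤ 2ω`.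
  -- There `1/k⁰` equals `ω⁻¹ τ(k⁰/ω)` with `τ` a cutoff inverse of one variable; vanishing of `τ`
  -- on `v ≤ 0` supplies the Heaviside factor.
  set a : ℝ := √(1 - ε / m ^ 2) with ha
  have hq : 0 < 1 - ε / m ^ 2 := by rw [sub_pos, div_lt_one hm2]; exact hε
  have ha0 : 0 < a := Real.sqrt_pos.2 hq
  have ha2 : a ^ 2 = 1 - ε / m ^ 2 := Real.sq_sqrt hq.le
  have hε1 : 0 < ε / m ^ 2 := by positivity
  have ha1 : a < 2 := by nlinarith
  obtain ⟨τ, hτ, hτ0, hτ1⟩ := exists_smooth_inv_cutoff ha0 ha1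
  refine ⟨fun k => ((φ (minkowskiSq k - m ^ 2) * (energy (m ^ 2) k.2)⁻¹ *
    τ (k.1 * (energy (m ^ 2) k.2)⁻¹) : ℝ) : ℂ), ?_, fun k hk => ?_, fun k hk => ?_⟩
  · exact hasTemperateGrowth_ofReal (((hφT.comp (hasTemperateGrowth_minkowskiSq_sub m)).mul
      (hasTemperateGrowth_inv_energy hm)).mul
        (hτ.comp (hasTemperateGrowth_fst.mul (hasTemperateGrowth_inv_energy hm))))
  · have hw : 0 < energy (m ^ 2) k.2 := hm.trans_le (le_energy hm k.2)
    simp only [hτ0 _ (mul_nonpos_of_nonpos_of_nonneg hk (inv_pos.2 hw).le), mul_zero,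
      Complex.ofReal_zero]
  · have hmw := le_energy hm k.2
    have hw : 0 < energy (m ^ 2) k.2 := hm.trans_le hmw
    by_cases h : φ (minkowskiSq k - m ^ 2) = 0
    · simp [h]
    · obtain ⟨h1, h2⟩ := hs (subset_tsupport φ h)
      rw [minkowskiSq_sub] at h1 h2
      set w := energy (m ^ 2) k.2
      have hww : m ^ 2 ≤ w ^ 2 := by gcongr
      have hv : k.1 * w⁻¹ = k.1 / w := rfl
      have hlow : a ≤ k.1 * w⁻¹ := by
        rw [hv]
        refine le_of_sq_le_sq ?_ (by positivity)
        rw [ha2, div_pow, le_div_iff₀ (by positivity)]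
        have : ε ≤ ε / m ^ 2 * w ^ 2 := by
          rw [div_mul_eq_mul_div, le_div_iff₀ hm2]
          gcongr
        nlinarith
      have hup : k.1 * w⁻¹ ≤ 2 := by
        rw [hv, div_le_iff₀ hw]
        nlinarith
      have hτk := hτ1 _ hlow hup
      change ((φ (minkowskiSq k - m ^ 2) * w⁻¹ * τ (k.1 * w⁻¹) : ℝ) : ℂ) = _
      rw [hτk, mul_inv, inv_inv]
      push_cast
      have : (w : ℂ) ≠ 0 := Complex.ofReal_ne_zero.2 hw.ne'
      field_simp

theorem chiDipole_outgoing (m : ℝ) (φ : ℝ → ℝ) (t : ℝ) :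
    chiDipole (d := d) m φ t .outgoing = chiDipole m φ (-t) .incoming := by
  ext k
  simp only [chiDipole, chi, Complex.ofReal_neg, mul_neg, neg_mul, neg_neg, neg_div,
    sub_eq_add_neg]

theorem minkowskiSq_reflect (k : Momentum d) :
    minkowskiSq ((-k.1, k.2) : Momentum d) = minkowskiSq k := by
  simp [minkowskiSq]

/-- Moving a factor `1/k⁰` into the smooth cutoff `η` turns the singular factor `1 + it u/(2k⁰)`
into `k⁰ + (it/2) u`. The right-hand side is thus visibly smooth and has the shape required by
`pvHalf_eq`. -/
theorem chiDipole_incoming {m : ℝ} {φ : ℝ → ℝ} (t : ℝ) {η : Momentum d → ℂ}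
    (h0 : ∀ k, k.1 ≤ 0 → η k = 0)
    (h1 : ∀ k, 0 < k.1 → η k = (φ (minkowskiSq k - m ^ 2) : ℂ) / (k.1 : ℂ)) (k : Momentum d) :
    chiDipole m φ t .incoming k =
      ((k.1 : ℂ) + Complex.I * t / 2 * ((minkowskiSq k - m ^ 2 : ℝ) : ℂ)) *
        Complex.exp (-Complex.I * ((k.1 - energy (m ^ 2) k.2 : ℝ) : ℂ) * (t : ℂ)) * η k
      + (-(k.1 : ℂ) - Complex.I * t / 2 * ((minkowskiSq k - m ^ 2 : ℝ) : ℂ)) *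
        Complex.exp (-Complex.I * ((k.1 + energy (m ^ 2) k.2 : ℝ) : ℂ) * (t : ℂ)) *
          η (-k.1, k.2) := by
  simp only [chiDipole, chi, chiPos, chiNeg]
  rcases lt_trichotomy k.1 0 with h | h | h
  · have hk : (k.1 : ℂ) ≠ 0 := Complex.ofReal_ne_zero.2 h.ne
    rw [h0 k h.le, h1 (-k.1, k.2) (by simpa using h), if_neg (by linarith), if_pos h,
      minkowskiSq_reflect]
    push_cast
    field_simp
    ring
  · rw [h0 k h.le, h0 (-k.1, k.2) (by simp [h]), if_neg (by linarith), if_neg (by linarith)]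
    simp
  · have hk : (k.1 : ℂ) ≠ 0 := Complex.ofReal_ne_zero.2 h.ne'
    rw [h1 k h, h0 (-k.1, k.2) (by simpa using h.le), if_pos h, if_neg (by linarith)]
    push_cast
    field_simp
    ring

theorem hasTemperateGrowth_chiDipole_incoming {m ε : ℝ} (hm : 0 < m) (hε0 : 0 < ε)
    (hε : ε < m ^ 2)
    {φ : ℝ → ℝ} (hφ : ContDiff ℝ ∞ φ) (hs : tsupport φ ⊆ Set.Ioo (-ε) ε) (t : ℝ) :
    (chiDipole (d := d) m φ t .incoming).HasTemperateGrowth := by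
  obtain ⟨η, hη, h0, h1⟩ := exists_cutoff_div_energy (d := d) hm hε0 hε hφ hs
  rw [show chiDipole (d := d) m φ t .incoming = _ from funext (chiDipole_incoming t h0 h1)]
  have a1 := hasTemperateGrowth_ofReal (hasTemperateGrowth_fst (d := d))
  have a2 := (Function.HasTemperateGrowth.const (E := Momentum d) (Complex.I * t / 2)).mul
    (hasTemperateGrowth_ofReal (hasTemperateGrowth_minkowskiSq_sub (d := d) m))
  have a3 := hasTemperateGrowth_exp_phase_comp
    ((hasTemperateGrowth_fst (d := d)).sub (hasTemperateGrowth_energy hm)) t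
  have a4 := hasTemperateGrowth_exp_phase_comp
    ((hasTemperateGrowth_fst (d := d)).add (hasTemperateGrowth_energy hm)) t
  exact (((a1.add a2).mul a3).mul hη).add
    (((a1.neg.sub a2).mul a4).mul (hasTemperateGrowth_reflect hη))

/-! ### The limit of the incoming and outgoing multipliers -/

theorem tendsto_pvInvSq_incoming {m ε : ℝ} (hm : 0 < m) (hε0 : 0 < ε) (hε : ε < m ^ 2)
    {φ : ℝ → ℝ} (hφ : ContDiff ℝ ∞ φ) (hs : tsupport φ ⊆ Set.Ioo (-ε) ε)
    (h1 : ∀ κ ∈ Set.Ioo (-(ε / 2)) (ε / 2), φ κ = 1) (f : 𝓢(Momentum d, ℂ))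
    {l l' : Filter ℝ} [l.IsCountablyGenerated] [l'.IsCountablyGenerated]
    (hl : l ≤ cocompact ℝ) (hl' : l' ≤ cocompact ℝ) (hneg : Tendsto (fun t => -t) l l') {L : ℂ}
    (hL : Tendsto (boxOsc m) l (𝓝 L)) (hL' : Tendsto (boxOsc m) l' (𝓝 (-L))) :
    Tendsto (fun t => pvInvSq hm (SchwartzMap.smulLeftCLM ℂ (chiDipole m φ t .incoming) f)) l
      (𝓝 (L * (shellDeriv hm f - shellDeriv hm (reflect f)))) := by
  obtain ⟨η, hη, he0, he1⟩ := exists_cutoff_div_energy (d := d) hm hε0 hε hφ hs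
  have hT := hasTemperateGrowth_chiDipole_incoming (d := d) hm hε0 hε hφ hs
  have hz : ∀ (f : 𝓢(Momentum d, ℂ)) (k : Momentum d), m ^ 2 ≤ |minkowskiSq k - m ^ 2| →
      SchwartzMap.smulLeftCLM ℂ η f k = 0 := by
    intro f k hk
    have : φ (minkowskiSq k - m ^ 2) = 0 := by
      by_contra h
      have := abs_lt.2 (hs (subset_tsupport φ h))
      linarith
    rw [SchwartzMap.smulLeftCLM_apply_apply hη]
    rcases le_or_gt k.1 0 with h | h
    · rw [he0 k h, zero_smul]
    · rw [he1 k h, this]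
      simp
  have hn : ∀ (f : 𝓢(Momentum d, ℂ)) (k : Momentum d), 0 < k.1 →
      |minkowskiSq k - m ^ 2| < ε / 2 → SchwartzMap.smulLeftCLM ℂ η f k = f k / (k.1 : ℂ) := by
    intro f k hk hu
    rw [SchwartzMap.smulLeftCLM_apply_apply hη, he1 k hk, h1 _ (abs_lt.1 hu), smul_eq_mul,
      Complex.ofReal_one]
    ring
  have hpos := tendsto_pvHalf hm (half_pos hε0) (f := f) (hz f) (hn f)
    (h := fun t => SchwartzMap.smulLeftCLM ℂ (chiDipole m φ t .incoming) f)
    (fun t k hk => by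
      rw [SchwartzMap.smulLeftCLM_apply_apply (hT t), SchwartzMap.smulLeftCLM_apply_apply hη,
        chiDipole_incoming t he0 he1, he0 (-k.1, k.2) (by simpa using hk.le), smul_eq_mul,
        smul_eq_mul]
      ring) hl hL
  -- After reflection the negative-energy phase `e^{-i(k⁰ + ω)t}` becomes `e^{i(k⁰ - ω)t}`: the
  -- positive-energy problem at time `-t`, whose limit carries `-L`.
  have hneg' := (tendsto_pvHalf hm (half_pos hε0) (f := reflect f) (hz (reflect f)) (hn (reflect f))
    (h := fun t => reflect (SchwartzMap.smulLeftCLM ℂ (chiDipole m φ (-t) .incoming) f))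
    (fun t k hk => by
      rw [reflect_apply, SchwartzMap.smulLeftCLM_apply_apply (hT (-t)),
        SchwartzMap.smulLeftCLM_apply_apply hη, reflect_apply, chiDipole_incoming (-t) he0 he1,
        he0 (-k.1, k.2) (by simpa using hk.le), smul_eq_mul, smul_eq_mul, minkowskiSq_reflect]
      have e : -Complex.I * ((-k.1 + energy (m ^ 2) k.2 : ℝ) : ℂ) * ((-t : ℝ) : ℂ)
          = -Complex.I * ((k.1 - energy (m ^ 2) k.2 : ℝ) : ℂ) * (t : ℂ) := by
        push_cast; ring
      simp only [e, neg_neg, Prod.mk.eta]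
      push_cast
      ring) hl' hL').comp hneg
  have := hpos.add hneg'
  simp only [Function.comp_def, neg_neg] at this
  rw [mul_sub, sub_eq_add_neg, ← neg_mul]
  exact this

end DipoleField

theorem mainTheorem3 (d : ℕ) (hd : 2 ≤ d) (m : ℝ) (hm : 0 < m) :
    ∃ Dp Dn P : 𝓢'(DipoleField.Momentum d, ℂ),
      DipoleField.IsDeltaPrimePos m Dp ∧
      DipoleField.IsDeltaPrimeNeg m Dn ∧
      DipoleField.IsPVInvSq m P ∧
      ∀ (ε : ℝ) (φ : ℝ → ℝ), 0 < ε → ε < m ^ 2 → ContDiff ℝ ∞ φ →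
        tsupport φ ⊆ Set.Ioo (-ε) ε →
        (∀ κ ∈ Set.Ioo (-(ε / 2)) (ε / 2), φ κ = 1) →
        ∀ a : DipoleField.Channel,
          (∀ t : ℝ, (DipoleField.chiDipole (d := d) m φ t a).HasTemperateGrowth) ∧
          Tendsto
            (fun t : ℝ => TemperedDistribution.smulLeftCLM ℂ (DipoleField.chiDipole m φ t a) P)
            atTop (𝓝 (DipoleField.dipoleDelta Dp Dn P a)) := by
  refine ⟨DipoleField.deltaPrimePos hm, DipoleField.deltaPrimeNeg hm, DipoleField.pvInvSq hm,
    DipoleField.isDeltaPrimePos_deltaPrimePos hm, DipoleField.isDeltaPrimeNeg_deltaPrimeNeg hm,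
    DipoleField.isPVInvSq_pvInvSq hm, fun ε φ hε0 hε hφ hs h1 a => ?_⟩
  have hT := DipoleField.hasTemperateGrowth_chiDipole_incoming (d := d) hm hε0 hε hφ hs
  have htop := DipoleField.tendsto_boxOsc_atTop hm
  have hbot := DipoleField.tendsto_boxOsc_atBot hm
  cases a with
  | incoming =>
    -- Convergence in `𝓢'` is tested on one Schwartz function at a time, and the multiplier acts by
    -- duality on it.
    refine ⟨hT, PointwiseConvergenceCLM.tendsto_iff_forall_tendsto.2 fun f => ?_⟩
    have := DipoleField.tendsto_pvInvSq_incoming hm hε0 hε hφ hs h1 f atTop_le_cocompact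
      atBot_le_cocompact tendsto_neg_atTop_atBot htop (by simpa using hbot)
    refine this.trans_eq (congrArg 𝓝 ?_)
    change _ = Complex.I * Real.pi * (DipoleField.deltaPrimePos hm f
      - DipoleField.deltaPrimeNeg hm f)
    rw [DipoleField.deltaPrimePos_apply, DipoleField.deltaPrimeNeg_apply]
    ring
  | loc =>
    refine ⟨fun t => Function.HasTemperateGrowth.const 1,
      PointwiseConvergenceCLM.tendsto_iff_forall_tendsto.2 fun f => ?_⟩
    have h : ∀ t, DipoleField.chiDipole (d := d) m φ t .loc = fun _ => 1 := fun _ => rfl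
    simp only [h, TemperedDistribution.smulLeftCLM_const, one_smul]
    exact tendsto_const_nhds
  | outgoing =>
    refine ⟨fun t => by rw [DipoleField.chiDipole_outgoing]; exact hT (-t),
      PointwiseConvergenceCLM.tendsto_iff_forall_tendsto.2 fun f => ?_⟩
    -- The outgoing multiplier at time `t` is the incoming one at `-t`, so the limit is taken along
    -- `atBot`, where the oscillatory integral tends to `+iπ`.
    have := (DipoleField.tendsto_pvInvSq_incoming hm hε0 hε hφ hs h1 f atBot_le_cocompact
      atTop_le_cocompact tendsto_neg_atBot_atTop hbot (by simpa using htop)).comp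
        tendsto_neg_atTop_atBot
    simp only [DipoleField.chiDipole_outgoing]
    refine this.trans_eq (congrArg 𝓝 ?_)
    change _ = -(Complex.I * Real.pi) * (DipoleField.deltaPrimePos hm f
      - DipoleField.deltaPrimeNeg hm f)
    rw [DipoleField.deltaPrimePos_apply, DipoleField.deltaPrimeNeg_apply]
    ring
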